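/- Conventions. The Fourier transform of $f$ on $\mathbb R$ is $\mathcal F(f)(y)=\int_{\mathbb R}e^{2\pi i xy}f(x)\,dx$, extended to tempered distributions by $\langle \mathcal F(D),\varphi\rangle=\langle D,\mathcal F(\varphi)\rangle$. A tempered distribution $D$ on $\mathbb R$ has \emph{property S} if there is $a>0$ such that both $D$ and $\mathcal F(D)$ vanish on $]-a,a[$. Let $D$ be a tempered distribution vanishing on some $]-a,a[$, $a>0$. For all sufficiently large integers $N$ there is a unique continuous function $C_N$ on $\mathbb R$ of at most polynomial growth, vanishing on $]-\infty,a]$, whose $N$-th distributional derivative coincides with $D$ on $]0,\infty[$. The right Mellin transform $\widehat D$ of $D$ is the analytic function given for $\mathrm{Re}(s)$ sufficiently large by $$\widehat D(s)=s(s+1)\cdots(s+N-1)\int_0^\infty C_N(x)\,x^{-(s+N)}\,dx$$ (this does not depend on $N$ or $a$), continued analytically to the largest possible half-plane $\mathrm{Re}(s)>\sigma$, or to all of $\mathbb C$. Theorem. Let $D$ be a tempered distribution on $\mathbb R$, even or odd, with property S. Then $\widehat D$ is an entire function. (1) If $D$ is even, then $\widehat D$ vanishes at $0,-2,-4,\dots$,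 and, as an identity of meromorphic functions on $\mathbb C$ (that is, at every $s$ where neither Gamma factor has a pole), $$\pi^{-\frac s2}\,\Gamma\!\left(\tfrac s2\right)\widehat D(s)=\pi^{-\frac{1-s}2}\,\Gamma\!\left(\tfrac{1-s}2\right)\widehat{\mathcal F(D)}(1-s).$$ (2) If $D$ is odd, then $\widehat D$ vanishes at $-1,-3,-5,\dots$, and, in the same sense, $$\pi^{-\frac{1+s}2}\,\Gamma\!\left(\tfrac{1+s}2\right)\widehat D(s)=-i\,\pi^{-\frac{2-s}2}\,\Gamma\!\left(\tfrac{2-s}2\right)\widehat{\mathcal F(D)}(1-s).$$ -/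

import Mathlib

open scoped SchwartzMap FourierTransform

namespace CoPoisson

/-- The reflected test function `x ↦ φ (-x)`. -/
noncomputable def reflect (φ : 𝓢(ℝ, ℂ)) : 𝓢(ℝ, ℂ) :=
  SchwartzMap.compCLMOfContinuousLinearEquiv ℂ (ContinuousLinearEquiv.neg ℝ) φ

theorem reflect_apply (φ : 𝓢(ℝ, ℂ)) (x : ℝ) : reflect φ x = φ (-x) := rfl

/-- `D` is even. -/
def IsEven (D : 𝓢'(ℝ, ℂ)) : Prop := ∀ φ : 𝓢(ℝ, ℂ), D (reflect φ) = D φ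

/-- `D` is odd. -/
def IsOdd (D : 𝓢'(ℝ, ℂ)) : Prop := ∀ φ : 𝓢(ℝ, ℂ), D (reflect φ) = -D φ

/-- The Fourier transform of tempered distributions with the sign `e^{+2πixy}`: the dual of
`φ ↦ (y ↦ ∫ e^{2πixy} φ(x) dx)`. In Mathlib this is the inverse Fourier transform `𝓕⁻`. -/
noncomputable def fourierPlus (D : 𝓢'(ℝ, ℂ)) : 𝓢'(ℝ, ℂ) := 𝓕⁻ D

theorem fourierPlus_apply (D : 𝓢'(ℝ, ℂ)) (φ : 𝓢(ℝ, ℂ)) : fourierPlus D φ = D (𝓕⁻ φ) := rfl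

theorem fourierInv_schwartz_apply (φ : 𝓢(ℝ, ℂ)) (y : ℝ) :
    (𝓕⁻ φ) y = ∫ x : ℝ, Complex.exp (2 * Real.pi * Complex.I * x * y) * φ x := by
  rw [SchwartzMap.fourierInv_coe, Real.fourierInv_eq']
  refine MeasureTheory.integral_congr_ae (Filter.Eventually.of_forall fun x => ?_)
  simp only [smul_eq_mul, RCLike.inner_apply, conj_trivial]
  congr 2
  push_cast
  ring

/-- Property S: the tempered distribution `D` and its Fourier transform both vanish on some
common interval `]-a, a[`, `a > 0`. -/
def PropertyS (D : 𝓢'(ℝ, ℂ)) : Prop :=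
  ∃ a : ℝ, 0 < a ∧ Distribution.IsVanishingOn D (Set.Ioo (-a) a) ∧
    Distribution.IsVanishingOn (fourierPlus D) (Set.Ioo (-a) a)

/-- `C` is continuous with at most polynomial growth, vanishes on `]-∞, a]`, and its `N`-th
distributional derivative coincides with `D` on `]0, ∞[`. When `a > 0`, and `D` vanishes on
`]-a, a[`, this says that `C` is the `N`-th primitive, vanishing on `]-∞, a]`, of the restriction of
`D` to `]0, ∞[` seen as a tempered distribution with support in `[a, ∞[`. -/
structure IsPrimitive (D : 𝓢'(ℝ, ℂ)) (a : ℝ) (N : ℕ) (C : ℝ → ℂ) : Prop where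
  continuous : Continuous C
  growth : ∃ (K : ℝ) (k : ℕ), ∀ x : ℝ, ‖C x‖ ≤ K * (1 + |x|) ^ k
  eq_zero : ∀ x : ℝ, x ≤ a → C x = 0
  deriv_eq : ∀ φ : 𝓢(ℝ, ℂ), tsupport (φ : ℝ → ℂ) ⊆ Set.Ioi 0 →
    D φ = (-1) ^ N * ∫ x : ℝ, C x * iteratedDeriv N (φ : ℝ → ℂ) x

/-- The open half-plane `Re s > σ`; for `σ = ⊥` it is all of `ℂ`. -/
def halfPlane (σ : EReal) : Set ℂ := {s : ℂ | σ < (s.re : EReal)}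

/-- `F` is, on the half-plane `Re s > σ`, an analytic continuation of the right Mellin transform
of (the restriction to `]0, ∞[` of) `D`, which is given for all `s` with sufficiently large real
part by `s (s + 1) ⋯ (s + N - 1) ∫₀^∞ C(x) x^{-(s + N)} dx`, `C` being the `N`-th primitive of `D`
for some `N`. (The integral converges absolutely when `Re s` is large.) -/
def IsMellinOn (D : 𝓢'(ℝ, ℂ)) (σ : EReal) (F : ℂ → ℂ) : Prop :=
  DifferentiableOn ℂ F (halfPlane σ) ∧
    ∃ a : ℝ, 0 < a ∧ ∃ (N : ℕ) (C : ℝ → ℂ), IsPrimitive D a N C ∧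
      ∃ σ₀ : ℝ, ∀ s : ℂ, σ₀ < s.re →
        F s = (ascPochhammer ℂ N).eval s * ∫ x in Set.Ioi (0 : ℝ), C x * (x : ℂ) ^ (-(s + N))

/-- The left end of the largest half-plane to which the right Mellin transform continues. -/
noncomputable def mellinAbscissa (D : 𝓢'(ℝ, ℂ)) : EReal :=
  sInf {σ : EReal | ∃ F : ℂ → ℂ, IsMellinOn D σ F}

/-- The right Mellin transform of `D`, continued analytically to the largest possible half-plane
(values outside that half-plane have no meaning). -/
noncomputable def rightMellin (D : 𝓢'(ℝ, ℂ)) : ℂ → ℂ :=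
  Classical.epsilon (IsMellinOn D (mellinAbscissa D))

end CoPoisson

open CoPoisson

/-! Pair `D` with the dilates of a Fourier eigenfunction `φ` of the same parity (`gaussian` or
`oddGaussian`): `theta D φ t` is `D` applied to `x ↦ φ (t x)`. As `D` vanishes near `0`, this decays
faster than every power as `t → ∞`. Fourier inversion and `𝓕 φ = c • φ` relate `t → 0` for `D` to `t
→ ∞` for `fourierPlus D` (`theta_one_div`), and that distribution vanishes near `0` too. So the
Mellin transform of `theta D φ` is entire and satisfies a functional equation with constant `c`
(`differentiable_mellin_theta`).

For large `Re s`, Fubini and integration by parts show that it equals `2 * mellin φ s` times the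
right Mellin transform of `D` (`exists_mellin_theta_eq`). Since `2 * mellin φ s` is `Gammaℝ s` or
`Gammaℝ (s + 1)`, whose inverse is entire, dividing continues the right Mellin transform to all of
`ℂ`; the zeros of the inverse Gamma factor are the trivial zeros (`rightMellin_eq`).

Primitives exist by a structure theorem (`exists_isPrimitive`): away from `0`, `D` is bounded by one
weighted `L²` norm of one derivative, so Riesz represents it by a function. -/

namespace CoPoisson

open MeasureTheory Set Filter Topology SchwartzMap

/-! ### Riesz representation without a closed range -/

section Riesz

/-- A linear functional bounded by the norm of a linear map into a Hilbert space is the inner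
product of that map with a fixed vector. -/
theorem exists_inner_eq_of_le_norm {V E : Type*} [AddCommGroup V] [Module ℂ V]
    [NormedAddCommGroup E] [InnerProductSpace ℂ E] [CompleteSpace E]
    (T : V →ₗ[ℂ] E) (L : V →ₗ[ℂ] ℂ) (C : ℝ) (h : ∀ v, ‖L v‖ ≤ C * ‖T v‖) :
    ∃ g : E, ∀ v, L v = inner ℂ g (T v) := by
  obtain ⟨S, hS⟩ := T.rangeRestrict.exists_rightInverse_of_surjective T.range_rangeRestrict
  have hS' : ∀ y, T (S y) = y := fun y => by
    have := congrArg Subtype.val (LinearMap.congr_fun hS y)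
    simpa using this
  let f : LinearMap.range T →L[ℂ] ℂ := (L ∘ₗ S).mkContinuous C fun y => by
    simpa [hS' y] using h (S y)
  -- The range of `T` need not be closed, hence Hahn–Banach before Riesz.
  obtain ⟨F, hF, -⟩ := exists_extension_norm_eq (LinearMap.range T) f
  refine ⟨(InnerProductSpace.toDual ℂ E).symm F, fun v => ?_⟩
  rw [InnerProductSpace.toDual_symm_apply]
  have h1 := hF ⟨T v, v, rfl⟩
  have h2 : f ⟨T v, v, rfl⟩ = L (S ⟨T v, v, rfl⟩) := rfl
  rw [h1, h2]
  -- `T` kills this difference, so the bound forces `L` to kill it as well.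
  have h3 := h (v - S ⟨T v, v, rfl⟩)
  rw [map_sub, map_sub, hS' ⟨T v, v, rfl⟩] at h3
  simpa [sub_eq_zero] using h3

end Riesz

section Derivatives

/-- The iterated derivative as an operator on Schwartz functions. -/
noncomputable def iterDeriv (n : ℕ) : 𝓢(ℝ, ℂ) →L[ℂ] 𝓢(ℝ, ℂ) := (derivCLM ℂ ℂ) ^ n

theorem iterDeriv_succ (n : ℕ) (φ : 𝓢(ℝ, ℂ)) :
    iterDeriv (n + 1) φ = derivCLM ℂ ℂ (iterDeriv n φ) := by
  simp [iterDeriv, pow_succ']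

theorem coe_iterDeriv (n : ℕ) (φ : 𝓢(ℝ, ℂ)) :
    (iterDeriv n φ : ℝ → ℂ) = iteratedDeriv n φ := by
  induction n with
  | zero => simp [iterDeriv]
  | succ n ih =>
    ext x
    rw [iterDeriv_succ, derivCLM_apply, ih, iteratedDeriv_succ]

theorem hasDerivAt_iterDeriv (n : ℕ) (φ : 𝓢(ℝ, ℂ)) (x : ℝ) :
    HasDerivAt (iterDeriv n φ) (iterDeriv (n + 1) φ x) x := by
  rw [iterDeriv_succ, derivCLM_apply]
  exact (iterDeriv n φ).hasDerivAt x

end Derivatives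

/-! ### Weighted `L¹` norms on a half-line -/

section Weight

theorem hasTemperateGrowth_one_add_pow (m : ℕ) :
    (fun t : ℝ => (1 + (t : ℂ)) ^ m).HasTemperateGrowth :=
  ((Function.HasTemperateGrowth.const (1 : ℂ)).add
    Complex.ofRealCLM.hasTemperateGrowth).pow m

/-- Multiplication of a Schwartz function by `(1 + t) ^ m`. -/
noncomputable def weight (m : ℕ) : 𝓢(ℝ, ℂ) →L[ℂ] 𝓢(ℝ, ℂ) :=
  smulLeftCLM ℂ fun t : ℝ => (1 + (t : ℂ)) ^ m

theorem weight_apply (m : ℕ) (φ : 𝓢(ℝ, ℂ)) (t : ℝ) : weight m φ t = (1 + (t : ℂ)) ^ m * φ t := by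
  rw [weight, smulLeftCLM_apply_apply (hasTemperateGrowth_one_add_pow m), smul_eq_mul]

theorem norm_weight_apply (m : ℕ) (φ : 𝓢(ℝ, ℂ)) {t : ℝ} (ht : 0 ≤ t) :
    ‖weight m φ t‖ = (1 + t) ^ m * ‖φ t‖ := by
  rw [weight_apply, norm_mul, norm_pow]
  congr 2
  rw [← Complex.ofReal_one, ← Complex.ofReal_add, Complex.norm_real, Real.norm_of_nonneg]
  positivity

/-- The `L¹` norm of `(1 + t) ^ m * φ t` on `]b, ∞[`. -/
noncomputable def tailNorm (b : ℝ) (m : ℕ) (φ : 𝓢(ℝ, ℂ)) : ℝ :=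
  ∫ t in Ioi b, (1 + t) ^ m * ‖φ t‖

variable {b : ℝ}

theorem integrableOn_tail (hb : 0 ≤ b) (m : ℕ) (φ : 𝓢(ℝ, ℂ)) :
    IntegrableOn (fun t => (1 + t) ^ m * ‖φ t‖) (Ioi b) :=
  ((weight m φ).integrable (μ := volume)).norm.integrableOn.congr_fun
    (fun _ ht => norm_weight_apply m φ (hb.trans (le_of_lt ht))) measurableSet_Ioi

theorem tailNorm_nonneg (hb : 0 ≤ b) (m : ℕ) (φ : 𝓢(ℝ, ℂ)) : 0 ≤ tailNorm b m φ :=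
  setIntegral_nonneg measurableSet_Ioi fun t ht => by
    have : 0 ≤ t := hb.trans (le_of_lt ht)
    positivity

theorem tailNorm_mono (hb : 0 ≤ b) {m m' : ℕ} (h : m ≤ m') (φ : 𝓢(ℝ, ℂ)) :
    tailNorm b m φ ≤ tailNorm b m' φ :=
  setIntegral_mono_on (integrableOn_tail hb m φ) (integrableOn_tail hb m' φ) measurableSet_Ioi
    fun t ht => by
      have : 0 ≤ t := hb.trans (le_of_lt ht)
      gcongr
      linarith

theorem tendsto_atTop_zero (φ : 𝓢(ℝ, ℂ)) : Tendsto φ atTop (𝓝 0) :=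
  φ.tendsto_cocompact.mono_left atTop_le_cocompact

theorem integral_Ioi_deriv (φ : 𝓢(ℝ, ℂ)) (x : ℝ) : ∫ t in Ioi x, derivCLM ℂ ℂ φ t = -φ x := by
  have := integral_Ioi_of_hasDerivAt_of_tendsto (f := φ) (f' := derivCLM ℂ ℂ φ) (a := x)
    φ.continuous.continuousWithinAt (fun t _ => φ.hasDerivAt t)
    (derivCLM ℂ ℂ φ).integrable.integrableOn (tendsto_atTop_zero φ)
  simpa using this

/-- Write `φ x` as minus the integral of its derivative over `]x, ∞[`; the weight increases, so it
may be moved inside. -/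
theorem pow_mul_norm_le_tailNorm_deriv (hb : 0 ≤ b) (m : ℕ) (φ : 𝓢(ℝ, ℂ)) {x : ℝ} (hx : b ≤ x) :
    (1 + x) ^ m * ‖φ x‖ ≤ tailNorm b m (derivCLM ℂ ℂ φ) := by
  have hx0 : 0 ≤ x := hb.trans hx
  calc (1 + x) ^ m * ‖φ x‖ = (1 + x) ^ m * ‖∫ t in Ioi x, derivCLM ℂ ℂ φ t‖ := by
        rw [integral_Ioi_deriv, norm_neg]
    _ ≤ (1 + x) ^ m * ∫ t in Ioi x, ‖derivCLM ℂ ℂ φ t‖ := by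
        gcongr
        exact norm_integral_le_integral_norm _
    _ = ∫ t in Ioi x, (1 + x) ^ m * ‖derivCLM ℂ ℂ φ t‖ := (integral_const_mul _ _).symm
    _ ≤ ∫ t in Ioi x, (1 + t) ^ m * ‖derivCLM ℂ ℂ φ t‖ := by
        refine setIntegral_mono_on ((derivCLM ℂ ℂ φ).integrable.norm.const_mul _).integrableOn
          (integrableOn_tail hx0 m _) measurableSet_Ioi fun t ht => ?_
        have : x ≤ t := le_of_lt ht
        gcongr
    _ ≤ tailNorm b m (derivCLM ℂ ℂ φ) := by
        refine setIntegral_mono_set (integrableOn_tail hb m _) ?_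
          (Ioi_subset_Ioi hx).eventuallyLE
        filter_upwards [ae_restrict_mem measurableSet_Ioi] with t ht
        have : 0 ≤ t := hb.trans (le_of_lt ht)
        simp only [Pi.zero_apply]
        positivity

theorem integrableOn_one_add_inv_sq (hb : 0 ≤ b) :
    IntegrableOn (fun t : ℝ => ((1 + t) ^ 2)⁻¹) (Ioi b) := by
  refine (integrable_inv_one_add_sq.integrableOn).mono' (Measurable.aestronglyMeasurable
    (by fun_prop)) ?_
  filter_upwards [ae_restrict_mem measurableSet_Ioi] with t ht
  have : 0 ≤ t := hb.trans (le_of_lt ht)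
  rw [Real.norm_of_nonneg (by positivity)]
  gcongr
  nlinarith

/-- Two extra powers of the weight pay for integrating the pointwise bound, through the integral of
`(1 + t)⁻²`. -/
theorem exists_tailNorm_le_deriv (hb : 0 ≤ b) :
    ∃ C : ℝ, 0 ≤ C ∧ ∀ (m : ℕ) (φ : 𝓢(ℝ, ℂ)),
      tailNorm b m φ ≤ C * tailNorm b (m + 2) (derivCLM ℂ ℂ φ) := by
  refine ⟨∫ t in Ioi b, ((1 + t) ^ 2)⁻¹, by positivity, fun m φ => ?_⟩
  rw [← integral_mul_const]
  refine setIntegral_mono_on (integrableOn_tail hb m φ)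
    ((integrableOn_one_add_inv_sq hb).mul_const _) measurableSet_Ioi fun t ht => ?_
  have h0 : 0 ≤ t := hb.trans (le_of_lt ht)
  have := pow_mul_norm_le_tailNorm_deriv hb (m + 2) φ (le_of_lt ht)
  rw [inv_mul_eq_div, le_div_iff₀ (by positivity)]
  calc _ = (1 + t) ^ (m + 2) * ‖φ t‖ := by ring
    _ ≤ _ := this

/-- `p` is bounded by a multiple of some norm `tailNorm b m (iterDeriv n φ)`. -/
def TailBounded (b : ℝ) (p : 𝓢(ℝ, ℂ) → ℝ) : Prop :=
  ∃ C : ℝ, 0 ≤ C ∧ ∃ m n : ℕ, ∀ φ, p φ ≤ C * tailNorm b m (iterDeriv n φ)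

theorem exists_tailNorm_iterDeriv_le (hb : 0 ≤ b) (n k : ℕ) :
    ∃ C : ℝ, 0 ≤ C ∧ ∀ (m : ℕ) (φ : 𝓢(ℝ, ℂ)),
      tailNorm b m (iterDeriv n φ) ≤ C * tailNorm b (m + 2 * k) (iterDeriv (n + k) φ) := by
  induction k with
  | zero => exact ⟨1, zero_le_one, fun m φ => by simp⟩
  | succ k ih =>
    obtain ⟨C, hC, h⟩ := ih
    obtain ⟨C', hC', h'⟩ := exists_tailNorm_le_deriv hb
    refine ⟨C * C', by positivity, fun m φ => (h m φ).trans ?_⟩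
    rw [mul_assoc]
    gcongr
    rw [← add_assoc n, iterDeriv_succ]
    exact h' _ _

theorem TailBounded.mono {p q : 𝓢(ℝ, ℂ) → ℝ} (hq : TailBounded b q) (h : ∀ φ, p φ ≤ q φ) :
    TailBounded b p :=
  let ⟨C, hC, m, n, H⟩ := hq
  ⟨C, hC, m, n, fun φ => (h φ).trans (H φ)⟩

theorem TailBounded.const_mul {p : 𝓢(ℝ, ℂ) → ℝ} (hp : TailBounded b p) {c : ℝ} (hc : 0 ≤ c) :
    TailBounded b fun φ => c * p φ :=
  let ⟨C, hC, m, n, H⟩ := hp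
  ⟨c * C, by positivity, m, n, fun φ => by
    rw [mul_assoc]
    exact mul_le_mul_of_nonneg_left (H φ) hc⟩

/-- Both bounds can be raised to derivative order `n + n'` by increasing the weight. So finitely
many seminorms reduce to a single norm, as the Riesz argument requires. -/
theorem TailBounded.add (hb : 0 ≤ b) {p q : 𝓢(ℝ, ℂ) → ℝ} (hp : TailBounded b p)
    (hq : TailBounded b q) : TailBounded b fun φ => p φ + q φ := by
  obtain ⟨C, hC, m, n, H⟩ := hp
  obtain ⟨C', hC', m', n', H'⟩ := hq
  obtain ⟨A, hA, h⟩ := exists_tailNorm_iterDeriv_le hb n n'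
  obtain ⟨A', hA', h'⟩ := exists_tailNorm_iterDeriv_le hb n' n
  refine ⟨C * A + C' * A', by positivity, (m + 2 * n') + (m' + 2 * n), n + n', fun φ => ?_⟩
  have h1 : p φ ≤ C * (A * tailNorm b ((m + 2 * n') + (m' + 2 * n)) (iterDeriv (n + n') φ)) := by
    refine (H φ).trans (mul_le_mul_of_nonneg_left ((h m φ).trans ?_) hC)
    exact mul_le_mul_of_nonneg_left (tailNorm_mono hb (by omega) _) hA
  have h2 : q φ ≤ C' * (A' * tailNorm b ((m + 2 * n') + (m' + 2 * n)) (iterDeriv (n + n') φ)) := by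
    refine (H' φ).trans (mul_le_mul_of_nonneg_left ((h' m' φ).trans ?_) hC')
    rw [add_comm n' n]
    exact mul_le_mul_of_nonneg_left (tailNorm_mono hb (by omega) _) hA'
  calc p φ + q φ ≤ _ := add_le_add h1 h2
    _ = _ := by ring

theorem TailBounded.sum (hb : 0 ≤ b) {ι : Type*} (s : Finset ι) {p : ι → 𝓢(ℝ, ℂ) → ℝ}
    (hp : ∀ i ∈ s, TailBounded b (p i)) : TailBounded b fun φ => ∑ i ∈ s, p i φ := by
  classical
  induction s using Finset.induction_on with
  | empty => exact ⟨0, le_rfl, 0, 0, fun φ => by simp⟩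
  | insert i s hi ih =>
    simp only [Finset.sum_insert hi]
    exact (hp i (by simp)).add hb (ih fun j hj => hp j (by simp [hj]))

end Weight

/-! ### Smooth cutoff away from the origin -/

section Cutoff

/-- A smooth function that vanishes on `]-∞, b]` and equals `1` on `[2 b, ∞[`. -/
noncomputable def cutoff (b : ℝ) (x : ℝ) : ℂ := (Real.smoothTransition (x / b - 1) : ℝ)

variable {b : ℝ}

theorem cutoff_of_le (hb : 0 < b) {x : ℝ} (hx : x ≤ b) : cutoff b x = 0 := by
  rw [cutoff, Real.smoothTransition.zero_of_nonpos, Complex.ofReal_zero]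
  rw [sub_nonpos, div_le_one hb]
  exact hx

theorem cutoff_of_ge (hb : 0 < b) {x : ℝ} (hx : 2 * b ≤ x) : cutoff b x = 1 := by
  rw [cutoff, Real.smoothTransition.one_of_one_le, Complex.ofReal_one]
  rw [le_sub_iff_add_le, le_div_iff₀ hb]
  linarith

theorem contDiff_cutoff (b : ℝ) {n : ℕ∞} : ContDiff ℝ n (cutoff b) :=
  Complex.ofRealCLM.contDiff.comp (Real.smoothTransition.contDiff.comp
    ((contDiff_id.div_const b).sub contDiff_const))

theorem hasTemperateGrowth_cutoff (hb : 0 < b) : (cutoff b).HasTemperateGrowth := by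
  have hd : Differentiable ℝ (cutoff b) := (contDiff_cutoff b (n := 1)).differentiable (by simp)
  refine Function.HasTemperateGrowth.of_fderiv (k := 0) (C := 1) ?_ hd fun x => ?_
  · refine HasCompactSupport.hasTemperateGrowth ?_
      ((contDiff_cutoff b (n := ⊤)).fderiv_right (by simp))
    refine HasCompactSupport.intro (isCompact_Icc (a := b) (b := 2 * b)) fun x hx => ?_
    have hx : x < b ∨ 2 * b < x := by
      by_contra! h
      exact hx ⟨h.1, h.2⟩
    have hc : ∃ c : ℂ, cutoff b =ᶠ[𝓝 x] fun _ => c := by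
      rcases hx with hx | hx
      · exact ⟨0, (eventually_lt_nhds hx).mono fun y hy => cutoff_of_le hb hy.le⟩
      · exact ⟨1, (eventually_gt_nhds hx).mono fun y hy => cutoff_of_ge hb hy.le⟩
    obtain ⟨c, hc⟩ := hc
    rw [hc.fderiv_eq]
    simp
  · rw [cutoff, Complex.norm_real, Real.norm_of_nonneg (Real.smoothTransition.nonneg _)]
    simpa using Real.smoothTransition.le_one _

/-- Multiplication of a Schwartz function by `cutoff b`. -/
noncomputable def cutoffMul (b : ℝ) : 𝓢(ℝ, ℂ) →L[ℂ] 𝓢(ℝ, ℂ) := smulLeftCLM ℂ (cutoff b)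

theorem cutoffMul_apply (hb : 0 < b) (φ : 𝓢(ℝ, ℂ)) (x : ℝ) :
    cutoffMul b φ x = cutoff b x * φ x := by
  rw [cutoffMul, smulLeftCLM_apply_apply (hasTemperateGrowth_cutoff hb), smul_eq_mul]

theorem tsupport_cutoffMul_subset (hb : 0 < b) (φ : 𝓢(ℝ, ℂ)) :
    tsupport (cutoffMul b φ) ⊆ Ici b := by
  refine closure_minimal (fun x hx => ?_) isClosed_Ici
  by_contra h
  exact hx (by rw [cutoffMul_apply hb, cutoff_of_le hb (not_le.1 h).le, zero_mul])

end Cutoff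

/-! ### Structure theorem and existence of primitives -/

section Structure

variable {b : ℝ}

/-- By Leibniz: derivatives of the cutoff grow polynomially, and each derivative of `φ` on `[b, ∞[`
is controlled by a tail norm of the next one. -/
theorem tailBounded_seminorm_cutoffMul (hb : 0 < b) (k n : ℕ) :
    TailBounded b fun φ => SchwartzMap.seminorm ℂ k n (cutoffMul b φ) := by
  obtain ⟨K, C, hC, hχ⟩ := (hasTemperateGrowth_cutoff hb).norm_iteratedFDeriv_le_uniform n
  have key : TailBounded b fun φ => ∑ i ∈ Finset.range (n + 1),
      (n.choose i * C) * tailNorm b (k + K) (iterDeriv (n - i + 1) φ) :=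
    TailBounded.sum hb.le _ fun i _ =>
      TailBounded.const_mul ⟨1, zero_le_one, _, _, fun φ => (one_mul _).ge⟩ (by positivity)
  refine key.mono fun φ => SchwartzMap.seminorm_le_bound ℂ k n _ ?_ fun x => ?_
  · exact Finset.sum_nonneg fun i _ => mul_nonneg (by positivity) (tailNorm_nonneg hb.le _ _)
  rcases lt_or_ge x b with hx | hx
  · have h0 : iteratedFDeriv ℝ n (cutoffMul b φ) x = 0 := by
      by_contra h
      exact absurd (tsupport_cutoffMul_subset hb φ (support_iteratedFDeriv_subset n h))
        (not_le.2 hx)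
    rw [h0, norm_zero, mul_zero]
    exact Finset.sum_nonneg fun i _ => mul_nonneg (by positivity) (tailNorm_nonneg hb.le _ _)
  · have hx0 : 0 ≤ x := hb.le.trans hx
    have h1 : (cutoffMul b φ : ℝ → ℂ) = fun y => cutoff b y * φ y :=
      funext (cutoffMul_apply hb φ)
    have h2 := norm_iteratedFDeriv_mul_le (contDiff_cutoff b (n := n)) (φ.smooth n) x le_rfl
    rw [h1]
    refine (mul_le_mul_of_nonneg_left h2 (by positivity)).trans ?_
    rw [Finset.mul_sum]
    refine Finset.sum_le_sum fun i hi => ?_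
    have h3 := hχ i (Finset.mem_range_succ_iff.1 hi) x
    have h4 : ‖iteratedFDeriv ℝ (n - i) φ x‖ = ‖iterDeriv (n - i) φ x‖ := by
      rw [norm_iteratedFDeriv_eq_norm_iteratedDeriv, coe_iterDeriv]
    have h5 := pow_mul_norm_le_tailNorm_deriv hb.le (k + K) (iterDeriv (n - i) φ) hx
    rw [← iterDeriv_succ] at h5
    rw [h4]
    rw [Real.norm_of_nonneg hx0] at h3 ⊢
    calc x ^ k * (n.choose i * ‖iteratedFDeriv ℝ i (cutoff b) x‖ * ‖iterDeriv (n - i) φ x‖)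
        ≤ (1 + x) ^ k * (n.choose i * (C * (1 + x) ^ K) * ‖iterDeriv (n - i) φ x‖) := by
          gcongr
          linarith
      _ = (n.choose i * C) * ((1 + x) ^ (k + K) * ‖iterDeriv (n - i) φ x‖) := by ring
      _ ≤ _ := by gcongr

theorem tailBounded_apply_cutoffMul (hb : 0 < b) (D : 𝓢'(ℝ, ℂ)) :
    TailBounded b fun φ => ‖D (cutoffMul b φ)‖ := by
  let q : Seminorm ℂ 𝓢(ℝ, ℂ) := (normSeminorm ℂ ℂ).comp D.toLinearMap
  have hq : Continuous q := continuous_norm.comp (map_continuous D)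
  obtain ⟨s, C, -, h⟩ := Seminorm.bound_of_continuous (schwartz_withSeminorms ℂ ℝ ℂ) q hq
  have key : TailBounded b fun φ => C * ∑ i ∈ s, SchwartzMap.seminorm ℂ i.1 i.2 (cutoffMul b φ) :=
    (TailBounded.sum hb.le s fun i _ =>
      tailBounded_seminorm_cutoffMul hb i.1 i.2).const_mul C.2
  refine key.mono fun φ => ?_
  refine (h (cutoffMul b φ)).trans ?_
  change (C : ℝ) * _ ≤ _
  refine mul_le_mul_of_nonneg_left ?_ C.2
  refine (Seminorm.finset_sup_le_sum _ s _).trans (le_of_eq ?_)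
  simp only [_root_.sum_apply]
  rfl

instance hasTemperateGrowth_volume_restrict (s : Set ℝ) :
    (volume.restrict s : Measure ℝ).HasTemperateGrowth :=
  ⟨(volume : Measure ℝ).integrablePower,
    (Measure.integrable_pow_neg_integrablePower volume).restrict⟩

/-- The `L²` norm of a weighted Schwartz function controls its weighted `L¹` norm. -/
theorem exists_tailNorm_le_toLp (hb : 0 ≤ b) :
    ∃ C : ℝ, ∀ (m : ℕ) (φ : 𝓢(ℝ, ℂ)),
      tailNorm b m φ ≤ C * ‖(weight (m + 1) φ).toLp 2 (volume.restrict (Ioi b))‖ := by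
  refine ⟨(∫ t in Ioi b, ‖((1 + t)⁻¹ : ℝ)‖ ^ (2 : ℝ)) ^ (1 / (2 : ℝ)), fun m φ => ?_⟩
  have hM : MemLp (fun t : ℝ => (1 + t)⁻¹) 2 (volume.restrict (Ioi b)) := by
    rw [memLp_two_iff_integrable_sq (Measurable.aestronglyMeasurable (by fun_prop))]
    exact (integrableOn_one_add_inv_sq hb).congr_fun (fun t _ => by simp) measurableSet_Ioi
  -- Cauchy–Schwarz against the square integrable `(1 + t)⁻¹`, at the cost of one more power of the
  -- weight.
  have h := integral_mul_norm_le_Lp_mul_Lq (μ := volume.restrict (Ioi b)) (p := 2) (q := 2)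
    (f := fun t : ℝ => (1 + t)⁻¹) (g := fun t => ‖weight (m + 1) φ t‖) Real.HolderConjugate.two_two
    (by simpa using hM) (by simpa using ((weight (m + 1) φ).memLp 2 (volume.restrict (Ioi b))).norm)
  rw [SchwartzMap.norm_toLp' (by simp) (by simp)]
  simp only [norm_norm] at h
  simp only [ENNReal.toReal_ofNat, ← one_div (2 : ℝ)]
  refine le_trans (le_of_eq ?_) h
  refine setIntegral_congr_fun measurableSet_Ioi fun t ht => ?_
  have h0 : 0 ≤ t := hb.trans (le_of_lt ht)
  rw [norm_weight_apply _ _ h0, Real.norm_of_nonneg (by positivity)]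
  field_simp
  ring

theorem exists_integral_eq_apply_cutoffMul (hb : 0 < b) (D : 𝓢'(ℝ, ℂ)) :
    ∃ (m n : ℕ) (g : ℝ → ℂ), MemLp g 2 (volume.restrict (Ioi b)) ∧
      ∀ φ : 𝓢(ℝ, ℂ), D (cutoffMul b φ) =
        ∫ t in Ioi b, g t * ((1 + (t : ℂ)) ^ m * iterDeriv n φ t) := by
  obtain ⟨C, hC, m, n, h⟩ := tailBounded_apply_cutoffMul hb D
  obtain ⟨C', h'⟩ := exists_tailNorm_le_toLp hb.le
  let T : 𝓢(ℝ, ℂ) →ₗ[ℂ] Lp ℂ 2 (volume.restrict (Ioi b)) :=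
    (toLpCLM ℂ ℂ 2 (volume.restrict (Ioi b)) ∘L weight (m + 1) ∘L iterDeriv n).toLinearMap
  obtain ⟨g, hg⟩ := exists_inner_eq_of_le_norm T (D.toLinearMap ∘ₗ (cutoffMul b).toLinearMap)
    (C * C') fun φ => by
      refine (h φ).trans ?_
      rw [mul_assoc]
      exact mul_le_mul_of_nonneg_left (h' m _) hC
  -- The conjugate appears because the inner product is conjugate-linear in its first argument.
  refine ⟨m + 1, n, fun t => star (g t), (Lp.memLp g).star, fun φ => ?_⟩
  refine (hg φ).trans ?_
  rw [L2.inner_def]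
  refine integral_congr_ae ?_
  filter_upwards [(weight (m + 1) (iterDeriv n φ)).coeFn_toLp 2 (volume.restrict (Ioi b))] with t ht
  change inner ℂ (g t) ((weight (m + 1) (iterDeriv n φ)).toLp 2 (volume.restrict (Ioi b)) t) = _
  rw [ht, weight_apply, RCLike.inner_apply, mul_comm]
  rfl

/-- Integration by parts against a Schwartz function, for the primitive of a function integrable
on left half-lines. -/
theorem integral_mul_eq_neg_integral_primitive_mul {f : ℝ → ℂ} (hf : ∀ x, IntegrableOn f (Iic x))
    (hfm : AEStronglyMeasurable f) {K : ℝ} {k : ℕ}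
    (hK : ∀ x, ∫ t in Iic x, ‖f t‖ ≤ K * (1 + |x|) ^ k) (ψ : 𝓢(ℝ, ℂ)) :
    ∫ t, f t * ψ t = -∫ x, (∫ t in Iic x, f t) * derivCLM ℂ ℂ ψ x := by
  set ψ' := derivCLM ℂ ℂ ψ
  -- Both sides are iterated integrals of `f t * ψ' x` over `t < x`, up to sign.
  let F : ℝ → ℝ → ℂ := fun t x => (Iio x).indicator f t * ψ' x
  have hnorm : ∀ x, ∫ t, ‖F t x‖ = (∫ t in Iic x, ‖f t‖) * ‖ψ' x‖ := fun x => by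
    simp only [F, norm_mul, norm_indicator_eq_indicator_norm]
    rw [integral_mul_const, integral_indicator measurableSet_Iio, integral_Iic_eq_integral_Iio]
  have hmeas : AEStronglyMeasurable (Function.uncurry F) (volume.prod volume) := by
    have h1 : AEStronglyMeasurable (fun p : ℝ × ℝ => {p : ℝ × ℝ | p.1 < p.2}.indicator
        (fun p => f p.1) p) (volume.prod volume) :=
      hfm.comp_fst.indicator (measurableSet_lt measurable_fst measurable_snd)
    exact AEStronglyMeasurable.mul (β := ℂ) h1
      (ψ'.continuous.comp continuous_snd).aestronglyMeasurable
  -- Monotonicity serves to give measurability in `x`.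
  have hmono : Monotone fun x => ∫ t in Iic x, ‖f t‖ := fun x y hxy =>
    setIntegral_mono_set (hf y).norm (ae_of_all _ fun t => norm_nonneg _)
      (Iic_subset_Iic.2 hxy).eventuallyLE
  have hint : Integrable (Function.uncurry F) (volume.prod volume) := by
    rw [integrable_prod_iff' hmeas]
    refine ⟨ae_of_all _ fun x => ?_, ?_⟩
    · change Integrable fun t => (Iio x).indicator f t * ψ' x
      refine Integrable.mul_const ?_ _
      rw [integrable_indicator_iff measurableSet_Iio]
      exact (hf x).mono_set Iio_subset_Iic_self
    · have hb : Integrable fun x : ℝ => K * (1 + |x|) ^ k * ‖ψ' x‖ := by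
        have hw : ((fun x : ℝ => 2 ^ (k - 1) * (‖x‖ ^ 0 * ‖ψ' x‖ + ‖x‖ ^ k * ‖ψ' x‖))) = fun x : ℝ =>
          2 ^ (k - 1) * (1 + |x| ^ k) * ‖ψ' x‖ := by
            ext x
            rw [Real.norm_eq_abs]
            ring
        have := ((ψ'.integrable_pow_mul volume 0).add (ψ'.integrable_pow_mul volume k)).const_mul
          (2 ^ (k - 1) : ℝ)
        simp only [Pi.add_apply] at this
        rw [hw] at this
        have h2 : Integrable fun x : ℝ => (1 + |x|) ^ k * ‖ψ' x‖ := by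
          refine this.mono' (Continuous.aestronglyMeasurable (by fun_prop))
            (ae_of_all _ fun x => ?_)
          rw [Real.norm_of_nonneg (by positivity)]
          gcongr
          simpa using add_pow_le zero_le_one (abs_nonneg x) k
        simpa only [mul_assoc] using h2.const_mul K
      refine hb.mono' ?_ (ae_of_all _ fun x => ?_)
      · simp only [Function.uncurry, hnorm]
        exact (hmono.measurable.mul ψ'.continuous.norm.measurable).aestronglyMeasurable
      · simp only [Function.uncurry, hnorm]
        rw [Real.norm_of_nonneg (by positivity)]
        gcongr
        exact hK x
  have hswap := integral_integral_swap hint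
  have hl : ∀ t, ∫ x, F t x = -(f t * ψ t) := fun t => by
    have : ∀ x, F t x = f t * (Ioi t).indicator ψ' x := fun x => by
      by_cases h : t < x <;> simp [F, h]
    simp only [this]
    rw [integral_const_mul, integral_indicator measurableSet_Ioi, integral_Ioi_deriv, mul_neg]
  have hr : ∀ x, ∫ t, F t x = (∫ t in Iic x, f t) * ψ' x := fun x => by
    simp only [F]
    rw [integral_mul_const, integral_indicator measurableSet_Iio, integral_Iic_eq_integral_Iio]
  simp only [hl, hr, integral_neg] at hswap
  rw [← hswap, neg_neg]

/-- A tempered distribution vanishing near `0` has primitives of some order. -/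
theorem exists_isPrimitive {D : 𝓢'(ℝ, ℂ)} {a : ℝ} (ha : 0 < a)
    (hD : Distribution.IsVanishingOn D (Ioo (-a) a)) :
    ∃ b : ℝ, 0 < b ∧ ∃ (N : ℕ) (C : ℝ → ℂ), IsPrimitive D b N C := by
  -- With `2 * b < a` the cutoff is already `1` at `a`, so `D` does not see the part of `φ` it
  -- removes.
  obtain ⟨b, hb, hba⟩ : ∃ b, 0 < b ∧ 2 * b < a := ⟨a / 4, by positivity, by linarith⟩
  obtain ⟨m, n, g, hg, h⟩ := exists_integral_eq_apply_cutoffMul hb D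
  let f : ℝ → ℂ := (Ioi b).indicator fun t => g t * (1 + (t : ℂ)) ^ m
  have hgm : AEStronglyMeasurable g (volume.restrict (Ioi b)) := hg.1
  have hpm : AEStronglyMeasurable (fun t => g t * (1 + (t : ℂ)) ^ m) (volume.restrict (Ioi b)) :=
    hgm.mul (Continuous.aestronglyMeasurable (by fun_prop))
  have hfm : AEStronglyMeasurable f := by
    rw [aestronglyMeasurable_indicator_iff measurableSet_Ioi]
    exact hpm
  have hg2 : Integrable (fun t => ‖g t‖ ^ 2) (volume.restrict (Ioi b)) := hg.integrable_norm_pow (by simp)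
  have hmaj : ∀ x t, t ∈ Iic x → ‖f t‖ ≤
      (1 + |x|) ^ m * ((Ioi b).indicator (fun t => ‖g t‖ ^ 2) t + (Ioc b x).indicator 1 t) := by
    intro x t ht
    by_cases hbt : b < t
    · have h0 : 0 ≤ t := hb.le.trans hbt.le
      have ht' : t ≤ |x| := (le_trans ht (le_abs_self x))
      have h1 : ‖(1 + (t : ℂ)) ^ m‖ ≤ (1 + |x|) ^ m := by
        rw [norm_pow]
        gcongr
        refine (norm_add_le _ _).trans ?_
        rw [Complex.norm_real, norm_one, Real.norm_of_nonneg h0]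
        gcongr
      -- `g` is only square integrable; this gives integrability on bounded intervals with
      -- polynomial growth.
      have h2 : ‖g t‖ ≤ ‖g t‖ ^ 2 + 1 := by nlinarith [sq_nonneg (‖g t‖ - 1), norm_nonneg (g t)]
      have h3 : t ∈ Ioc b x := ⟨hbt, ht⟩
      simp only [f, indicator_of_mem (mem_Ioi.2 hbt), indicator_of_mem h3, Pi.one_apply, norm_mul]
      rw [mul_comm]
      gcongr
    · have h3 : t ∉ Ioc b x := fun h => hbt h.1
      simp [f, hbt]
  have hmajint : ∀ x, Integrable fun t => (1 + |x|) ^ m *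
      ((Ioi b).indicator (fun t => ‖g t‖ ^ 2) t + (Ioc b x).indicator (1 : ℝ → ℝ) t) := fun x => by
    refine Integrable.const_mul (Integrable.add ?_ ?_) _
    · rwa [integrable_indicator_iff measurableSet_Ioi]
    · rw [integrable_indicator_iff measurableSet_Ioc]
      exact integrableOn_const (by simp)
  have hf : ∀ x, IntegrableOn f (Iic x) := fun x => by
    refine (hmajint x).integrableOn.mono' hfm.restrict ?_
    filter_upwards [ae_restrict_mem measurableSet_Iic] with t ht using hmaj x t ht
  set A := ∫ t in Ioi b, ‖g t‖ ^ 2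
  have hA : 0 ≤ A := integral_nonneg fun t => by positivity
  have hK : ∀ x, ∫ t in Iic x, ‖f t‖ ≤ (A + 1) * (1 + |x|) ^ (m + 1) := fun x => by
    have h1 : ∫ t in Iic x, ‖f t‖ ≤ ∫ t in Iic x, (1 + |x|) ^ m *
        ((Ioi b).indicator (fun t => ‖g t‖ ^ 2) t + (Ioc b x).indicator (1 : ℝ → ℝ) t) :=
      setIntegral_mono_on (hf x).norm (hmajint x).integrableOn measurableSet_Iic (hmaj x)
    have h2 := setIntegral_le_integral (s := Iic x) (hmajint x) (ae_of_all _ fun t => by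
      have : 0 ≤ (Ioi b).indicator (fun t => ‖g t‖ ^ 2) t :=
        indicator_nonneg (fun _ _ => by positivity) _
      have : 0 ≤ (Ioc b x).indicator (1 : ℝ → ℝ) t :=
        indicator_nonneg (fun _ _ => zero_le_one) _
      simp only [Pi.zero_apply]
      positivity)
    refine h1.trans (h2.trans ?_)
    have i1 : Integrable ((Ioi b).indicator fun t => ‖g t‖ ^ 2) := by
      rwa [integrable_indicator_iff measurableSet_Ioi]
    have i2 : Integrable ((Ioc b x).indicator (1 : ℝ → ℝ)) := by
      rw [integrable_indicator_iff measurableSet_Ioc]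
      exact integrableOn_const (by simp)
    rw [integral_const_mul, integral_add i1 i2, integral_indicator measurableSet_Ioi,
      integral_indicator_one measurableSet_Ioc, measureReal_def, Real.volume_Ioc]
    have h3 : (ENNReal.ofReal (x - b)).toReal ≤ |x| := by
      rw [ENNReal.toReal_ofReal', sup_le_iff]
      exact ⟨by linarith [le_abs_self x], abs_nonneg x⟩
    calc (1 + |x|) ^ m * (A + (ENNReal.ofReal (x - b)).toReal)
        ≤ (1 + |x|) ^ m * ((A + 1) * (1 + |x|)) := by
          gcongr
          nlinarith [abs_nonneg x]
      _ = _ := by ring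
  have hzero : ∀ x ≤ b, ∫ t in Iic x, f t = 0 := fun x hx =>
    setIntegral_eq_zero_of_forall_eq_zero fun t ht =>
      indicator_of_notMem (not_lt.2 (le_trans ht hx)) _
  have hcont : Continuous fun x => ∫ t in Iic x, f t := by
    have : (fun x => ∫ t in Iic x, f t) = fun x => ∫ t in b..x, f t := by
      ext x
      rw [← intervalIntegral.integral_Iic_sub_Iic (hf b) (hf x), hzero b le_rfl, sub_zero]
    rw [this]
    refine intervalIntegral.continuous_primitive (fun c d => ?_) b
    exact ((hf (max c d)).mono_set fun t ht => ht.2).intervalIntegrable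
  -- One more integration makes the density continuous. The sign `(-1) ^ n` is there since the
  -- representation with `iterDeriv n φ` carries no sign, whereas `deriv_eq` asks for `(-1) ^ (n +
  -- 1)`.
  refine ⟨b, hb, n + 1, fun x => (-1) ^ n * ∫ t in Iic x, f t, ?_⟩
  refine ⟨hcont.const_mul _, ⟨A + 1, m + 1, fun x => ?_⟩, fun x hx => ?_, fun φ hφ => ?_⟩
  · rw [norm_mul, norm_pow, norm_neg, norm_one, one_pow, one_mul]
    exact (norm_integral_le_integral_norm _).trans (hK x)
  · rw [hzero x hx, mul_zero]
  · have h1 : D φ = D (cutoffMul b φ) := by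
      rw [← sub_eq_zero, ← map_sub]
      refine hD _ ((closure_minimal (t := tsupport φ ∩ Iic (2 * b)) (fun x hx => ?_)
        ((isClosed_tsupport _).inter isClosed_Iic)).trans fun x hx => ?_)
      · have hx' : φ x - cutoff b x * φ x ≠ 0 := by
          rw [← cutoffMul_apply hb]
          exact hx
        refine ⟨subset_tsupport _ fun h0 => hx' (by rw [h0]; simp), mem_Iic.2 (not_lt.1 fun h0 => hx' ?_)⟩
        rw [cutoff_of_ge hb h0.le, one_mul, sub_self]
      · have h2 : 0 < x := hφ hx.1
        have h3 : x ≤ 2 * b := hx.2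
        exact ⟨by linarith, by linarith⟩
    have h2 := integral_mul_eq_neg_integral_primitive_mul hf hfm hK (iterDeriv n φ)
    have h3 : ∫ t in Ioi b, g t * ((1 + (t : ℂ)) ^ m * iterDeriv n φ t) =
        ∫ t, f t * iterDeriv n φ t := by
      rw [← integral_indicator measurableSet_Ioi]
      refine integral_congr_ae (ae_of_all _ fun t => ?_)
      by_cases ht : b < t <;> simp [f, ht, mul_assoc]
    have h4 : ((-1 : ℂ) ^ n) * (-1) ^ n = 1 := by
      rw [← mul_pow]
      simp
    rw [h1, h, h3, h2, ← iterDeriv_succ, coe_iterDeriv]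
    simp only [mul_assoc, integral_const_mul]
    rw [pow_succ]
    linear_combination (-(∫ x, (∫ t in Iic x, f t) * iteratedDeriv (n + 1) φ x)) * (-h4)

end Structure

/-! ### Dilations, parity and the theta function -/

section Dilation

open scoped Classical in
/-- The dilated test function `x ↦ φ (t x)`, for `t ≠ 0`. -/
noncomputable def dilate (t : ℝ) (φ : 𝓢(ℝ, ℂ)) : 𝓢(ℝ, ℂ) :=
  if h : t ≠ 0 then
    compCLMOfContinuousLinearEquiv ℂ (ContinuousLinearEquiv.unitsEquivAut ℝ (Units.mk0 t h)) φ
  else 0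

theorem dilate_apply {t : ℝ} (ht : t ≠ 0) (φ : 𝓢(ℝ, ℂ)) (x : ℝ) : dilate t φ x = φ (t * x) := by
  simp [dilate, ht, mul_comm]

theorem iterDeriv_dilate {t : ℝ} (ht : t ≠ 0) (n : ℕ) (φ : 𝓢(ℝ, ℂ)) (x : ℝ) :
    iterDeriv n (dilate t φ) x = (t : ℂ) ^ n * iterDeriv n φ (t * x) := by
  induction n generalizing x with
  | zero => simp [iterDeriv, dilate_apply ht]
  | succ n ih =>
    rw [iterDeriv_succ, derivCLM_apply, funext ih]
    have h1 := ((hasDerivAt_iterDeriv n φ (t * x)).scomp x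
      ((hasDerivAt_id x).const_mul t)).const_mul ((t : ℂ) ^ n)
    refine h1.deriv.trans ?_
    simp only [mul_one, Complex.real_smul]
    ring

theorem reflect_dilate {t : ℝ} (ht : t ≠ 0) {φ : 𝓢(ℝ, ℂ)} {η : ℂ} (h : reflect φ = η • φ) :
    reflect (dilate t φ) = η • dilate t φ := by
  ext x
  have := congrArg (fun ψ : 𝓢(ℝ, ℂ) => ψ (t * x)) h
  simp only [reflect_apply, smul_apply] at this ⊢
  rw [dilate_apply ht, dilate_apply ht, ← this, mul_neg]

end Dilation

section Parity

/-- A distribution of parity `η` vanishing near `0`, evaluated at a test function of parity `η`, in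
terms of a primitive. -/
theorem apply_eq_two_mul_integral {D : 𝓢'(ℝ, ℂ)} {a b : ℝ} (ha : 0 < a) (hb : 0 < b)
    (hD : Distribution.IsVanishingOn D (Ioo (-a) a)) {η : ℂ} (hη : η * η = 1)
    (hpar : ∀ ψ, D (reflect ψ) = η * D ψ) {N : ℕ} {C : ℝ → ℂ} (hC : IsPrimitive D b N C)
    {ψ : 𝓢(ℝ, ℂ)} (hψ : reflect ψ = η • ψ) :
    D ψ = 2 * (-1) ^ N * ∫ x, C x * iterDeriv N ψ x := by
  -- `2 * c < a` puts the removed part of `ψ` where `D` vanishes; `2 * c ≤ b` makes the cutoff `1`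
  -- wherever `C` is nonzero.
  obtain ⟨c, hc, hca, hcb⟩ : ∃ c, 0 < c ∧ 2 * c < a ∧ 2 * c ≤ b := by
    refine ⟨min a b / 3, by positivity, ?_, ?_⟩
    · have := min_le_left a b
      linarith
    · have := min_le_right a b
      linarith
  set χψ := cutoffMul c ψ with hχψ
  have hψx : ∀ x, ψ (-x) = η * ψ x := fun x => by
    have := congrArg (fun ψ : 𝓢(ℝ, ℂ) => ψ x) hψ
    simpa [reflect_apply] using this
  -- Outside `[-2c, 2c]` one of the two cutoffs is `1` and the other `0`, so the parity of `ψ`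
  -- cancels everything there.
  have h1 : D (ψ - χψ - η • reflect χψ) = 0 := by
    refine hD _ ((closure_minimal (t := Icc (-(2 * c)) (2 * c)) (fun x hx => ?_)
      isClosed_Icc).trans (Icc_subset_Ioo (by linarith) hca))
    have hx' : ψ x - cutoff c x * ψ x - η * (cutoff c (-x) * ψ (-x)) ≠ 0 := by
      rw [← cutoffMul_apply hc, ← cutoffMul_apply hc]
      exact hx
    by_contra h
    rw [mem_Icc, not_and_or, not_le, not_le] at h
    rcases h with h | h
    · apply hx'
      rw [cutoff_of_le hc (by linarith), cutoff_of_ge hc (by linarith), hψx]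
      linear_combination (-ψ x) * hη
    · apply hx'
      rw [cutoff_of_ge hc h.le, cutoff_of_le hc (by linarith : -x ≤ c)]
      ring
  have h2 : D ψ = 2 * D χψ := by
    rw [map_sub, map_sub, map_smul, hpar, smul_eq_mul] at h1
    linear_combination h1 + D χψ * hη
  rw [h2, hC.deriv_eq χψ ((tsupport_cutoffMul_subset hc ψ).trans fun x hx => hc.trans_le hx),
    mul_assoc]
  congr 2
  refine integral_congr_ae (ae_of_all _ fun x => ?_)
  rcases le_or_gt x b with hx | hx
  · simp [hC.eq_zero x hx]
  · have h3 : (χψ : ℝ → ℂ) =ᶠ[𝓝 x] ψ := by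
      filter_upwards [eventually_gt_nhds (hcb.trans_lt hx)] with y hy
      rw [hχψ, cutoffMul_apply hc, cutoff_of_ge hc hy.le, one_mul]
    simp only
    rw [coe_iterDeriv, h3.iteratedDeriv_eq]

/-- `t ↦ D (φ (t ·))`. -/
noncomputable def theta (D : 𝓢'(ℝ, ℂ)) (φ : 𝓢(ℝ, ℂ)) (t : ℝ) : ℂ := D (dilate t φ)

/-- The chain rule yields the factor `t ^ N`, written as a complex power so that `mellin_cpow_smul`
turns it into the shift `s ↦ s + N`. -/
theorem theta_eq_integral {D : 𝓢'(ℝ, ℂ)} {a b : ℝ} (ha : 0 < a) (hb : 0 < b)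
    (hD : Distribution.IsVanishingOn D (Ioo (-a) a)) {η : ℂ} (hη : η * η = 1)
    (hpar : ∀ ψ, D (reflect ψ) = η * D ψ) {N : ℕ} {C : ℝ → ℂ} (hC : IsPrimitive D b N C)
    {φ : 𝓢(ℝ, ℂ)} (hφ : reflect φ = η • φ) {t : ℝ} (ht : 0 < t) :
    theta D φ t = (t : ℂ) ^ (N : ℂ) •
      ((2 * (-1) ^ N : ℂ) • ∫ x in Ioi b, C x * iterDeriv N φ (t * x)) := by
  rw [theta, apply_eq_two_mul_integral ha hb hD hη hpar hC (reflect_dilate ht.ne' hφ)]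
  have : ∫ x, C x * iterDeriv N (dilate t φ) x =
      ∫ x in Ioi b, (t : ℂ) ^ N * (C x * iterDeriv N φ (t * x)) := by
    rw [← integral_indicator measurableSet_Ioi]
    refine integral_congr_ae (ae_of_all _ fun x => ?_)
    by_cases hx : b < x
    · simp only [indicator_of_mem (mem_Ioi.2 hx), iterDeriv_dilate ht.ne']
      ring
    · simp [hx, hC.eq_zero x (not_lt.1 hx)]
  rw [this, integral_const_mul, Complex.cpow_natCast]
  simp only [smul_eq_mul]
  ring

theorem IsPrimitive.exists_norm_le_mul_pow {D : 𝓢'(ℝ, ℂ)} {b : ℝ} (hb : 0 < b) {N : ℕ} {C : ℝ → ℂ}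
    (hC : IsPrimitive D b N C) :
    ∃ (K : ℝ) (k : ℕ), 0 ≤ K ∧ ∀ x ∈ Ioi b, ‖C x‖ ≤ K * x ^ k := by
  obtain ⟨K, k, h⟩ := hC.growth
  have hK : 0 ≤ K := by simpa using (norm_nonneg _).trans (h 0)
  refine ⟨K * (1 / b + 1) ^ k, k, by positivity, fun x hx => (h x).trans ?_⟩
  have hx0 : 0 < x := hb.trans hx
  rw [abs_of_pos hx0, mul_assoc, ← mul_pow]
  gcongr
  have : 1 ≤ 1 / b * x := by
    rw [div_mul_eq_mul_div, one_mul, one_le_div hb]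
    exact le_of_lt hx
  linarith

end Parity

/-! ### Decay and Mellin transform of dilation integrals -/

section Kernel

variable {b K : ℝ} {k : ℕ} {C : ℝ → ℂ}

theorem integrableOn_inv_pow_add_two (hb : 0 < b) (j : ℕ) :
    IntegrableOn (fun x : ℝ => (x ^ (j + 2))⁻¹) (Ioi b) := by
  refine (integrableOn_Ioi_rpow_of_lt (a := -((j + 2 : ℕ) : ℝ)) ?_ hb).congr_fun
    (fun x hx => ?_) measurableSet_Ioi
  · push_cast
    have : (0 : ℝ) ≤ j := j.cast_nonneg
    linarith
  · simp only
    rw [Real.rpow_neg (hb.trans hx).le, Real.rpow_natCast]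

/-- Schwartz decay of order `k + j + 2` absorbs the growth of `C`. The free `j` gives any decay in
`t`, and an integrable power of `x` always remains because `b > 0`. -/
theorem exists_norm_mul_dilate_le (hb : 0 < b) (hK : 0 ≤ K) (hC : ∀ x ∈ Ioi b, ‖C x‖ ≤ K * x ^ k)
    (ψ : 𝓢(ℝ, ℂ)) (j : ℕ) :
    ∃ M : ℝ, 0 ≤ M ∧ ∀ t : ℝ, 0 < t → ∀ x ∈ Ioi b,
      ‖C x * ψ (t * x)‖ ≤ M * (t ^ (k + (j + 2)))⁻¹ * (x ^ (j + 2))⁻¹ := by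
  obtain ⟨M, hM, h⟩ := ψ.decay (k + (j + 2)) 0
  refine ⟨K * M, by positivity, fun t ht x hx => ?_⟩
  have hx0 : 0 < x := hb.trans hx
  have h1 := h (t * x)
  rw [norm_iteratedFDeriv_zero, Real.norm_of_nonneg (by positivity)] at h1
  have h2 : ‖ψ (t * x)‖ ≤ M * ((t * x) ^ (k + (j + 2)))⁻¹ := by
    rw [← div_eq_mul_inv, le_div_iff₀ (by positivity), mul_comm]
    exact h1
  rw [norm_mul]
  calc ‖C x‖ * ‖ψ (t * x)‖ ≤ (K * x ^ k) * (M * ((t * x) ^ (k + (j + 2)))⁻¹) := by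
        gcongr
        exact hC x hx
    _ = _ := by
        rw [mul_pow, pow_add x]
        field_simp

theorem exists_norm_integral_dilate_le (hb : 0 < b) (hK : 0 ≤ K)
    (hC : ∀ x ∈ Ioi b, ‖C x‖ ≤ K * x ^ k) (ψ : 𝓢(ℝ, ℂ)) (j : ℕ) :
    ∃ M : ℝ, ∀ t : ℝ, 0 < t →
      ‖∫ x in Ioi b, C x * ψ (t * x)‖ ≤ M * (t ^ (k + (j + 2)))⁻¹ := by
  obtain ⟨M, hM, h⟩ := exists_norm_mul_dilate_le hb hK hC ψ j
  refine ⟨M * ∫ x in Ioi b, (x ^ (j + 2))⁻¹, fun t ht => ?_⟩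
  have h1 := norm_integral_le_of_norm_le ((integrableOn_inv_pow_add_two hb j).const_mul
    (M * (t ^ (k + (j + 2)))⁻¹)) ((ae_restrict_mem measurableSet_Ioi).mono (h t ht))
  rw [integral_const_mul] at h1
  refine h1.trans (le_of_eq (by ring))

theorem continuousOn_integral_dilate (hb : 0 < b) (hK : 0 ≤ K) (hc : Continuous C)
    (hC : ∀ x ∈ Ioi b, ‖C x‖ ≤ K * x ^ k) (ψ : 𝓢(ℝ, ℂ)) :
    ContinuousOn (fun t : ℝ => ∫ x in Ioi b, C x * ψ (t * x)) (Ioi 0) := by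
  obtain ⟨M, hM, h⟩ := exists_norm_mul_dilate_le hb hK hC ψ 0
  refine continuousOn_of_forall_continuousAt fun t₀ (ht₀ : 0 < t₀) => ?_
  have ht : ∀ᶠ t in 𝓝 t₀, t₀ / 2 < t := eventually_gt_nhds (by linarith)
  refine continuousAt_of_dominated
    (bound := fun x => M * ((t₀ / 2) ^ (k + (0 + 2)))⁻¹ * (x ^ (0 + 2))⁻¹)
    (Eventually.of_forall fun t => Continuous.aestronglyMeasurable
      (hc.mul (ψ.continuous.comp (by fun_prop)))) ?_
    ((integrableOn_inv_pow_add_two hb 0).const_mul _) ?_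
  · filter_upwards [ht] with t ht
    filter_upwards [ae_restrict_mem measurableSet_Ioi] with x hx
    have ht0 : 0 < t := by linarith
    have hx0 : 0 < x := hb.trans hx
    refine (h t ht0 x hx).trans ?_
    gcongr
  · exact ae_of_all _ fun x => (continuous_const.mul (ψ.continuous.comp
      (by fun_prop))).continuousAt

theorem mellinConvergent_schwartz (ψ : 𝓢(ℝ, ℂ)) {s : ℂ} (hs : 0 < s.re) :
    MellinConvergent ψ s := by
  refine mellinConvergent_of_isBigO_rpow (a := s.re + 1) (b := 0)
    (ψ.continuous.locallyIntegrable.locallyIntegrableOn _) ?_ (by linarith) ?_ hs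
  · have := (ψ.isBigO_cocompact_rpow (-(s.re + 1))).mono atTop_le_cocompact
    refine this.congr' EventuallyEq.rfl ?_
    filter_upwards [eventually_gt_atTop 0] with x hx
    rw [Real.norm_of_nonneg hx.le]
  · simp only [neg_zero, Real.rpow_zero]
    exact (ψ.continuous.continuousAt.isBigO_one ℝ).mono nhdsWithin_le_nhds

/-- Integrate the derivative of `t ^ s * ψ t` over `]0, ∞[`; the boundary terms vanish since `Re s >
0` and `ψ` decays. -/
theorem mellin_deriv_schwartz (ψ : 𝓢(ℝ, ℂ)) {s : ℂ} (hs : 0 < s.re) :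
    mellin (derivCLM ℂ ℂ ψ) (s + 1) = -s * mellin ψ s := by
  have hs0 : s ≠ 0 := fun h => by simp [h] at hs
  have h1 : MellinConvergent ψ s := mellinConvergent_schwartz ψ hs
  have h2 : MellinConvergent (derivCLM ℂ ℂ ψ) (s + 1) :=
    mellinConvergent_schwartz _ (by simpa using by linarith)
  have hd : ∀ t ∈ Ioi (0 : ℝ), HasDerivAt (fun t : ℝ => (t : ℂ) ^ s * ψ t)
      (s * ((t : ℂ) ^ (s - 1) * ψ t) + (t : ℂ) ^ (s + 1 - 1) * derivCLM ℂ ℂ ψ t) t := fun t ht => by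
    have h3 : HasDerivAt (fun t : ℝ => (t : ℂ) ^ s) (s * (t : ℂ) ^ (s - 1)) t := by
      simpa using ((hasDerivAt_id (t : ℂ)).cpow_const (c := s)
        (Or.inl (by simpa using ht))).comp_ofReal
    convert! h3.mul (ψ.hasDerivAt t) using 1
    rw [add_sub_cancel_right, derivCLM_apply]
    ring
  have hint : IntegrableOn (fun t : ℝ => s * ((t : ℂ) ^ (s - 1) * ψ t) +
      (t : ℂ) ^ (s + 1 - 1) * derivCLM ℂ ℂ ψ t) (Ioi 0) := (h1.const_mul s).add h2
  have hlim : Tendsto (fun t : ℝ => (t : ℂ) ^ s * ψ t) atTop (𝓝 0) := by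
    have h4 := (ψ.isBigO_cocompact_rpow (-(s.re + 1))).mono atTop_le_cocompact
    obtain ⟨c, hc⟩ := h4.bound
    refine squeeze_zero_norm' (a := fun t => c * t ^ (-1 : ℝ)) ?_ ?_
    · filter_upwards [hc, eventually_gt_atTop 0] with t ht ht0
      rw [norm_mul, Complex.norm_cpow_eq_rpow_re_of_pos ht0]
      rw [Real.norm_of_nonneg (by positivity), Real.norm_of_nonneg ht0.le] at ht
      calc t ^ s.re * ‖ψ t‖ ≤ t ^ s.re * (c * t ^ (-(s.re + 1))) := by gcongr
        _ = c * (t ^ s.re * t ^ (-(s.re + 1))) := by ring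
        _ = _ := by
          rw [← Real.rpow_add ht0]
          ring_nf
    · simpa using (tendsto_rpow_neg_atTop zero_lt_one).const_mul c
  have hcont : ContinuousWithinAt (fun t : ℝ => (t : ℂ) ^ s * ψ t) (Ici 0) 0 :=
    ((Complex.continuousAt_ofReal_cpow_const 0 s (Or.inl hs)).mul
      ψ.continuous.continuousAt).continuousWithinAt
  have key := integral_Ioi_of_hasDerivAt_of_tendsto hcont hd hint hlim
  have h5 : IntegrableOn (fun t : ℝ => s * ((t : ℂ) ^ (s - 1) * ψ t)) (Ioi 0) := h1.const_mul s
  have h6 : IntegrableOn (fun t : ℝ => (t : ℂ) ^ (s + 1 - 1) * derivCLM ℂ ℂ ψ t) (Ioi 0) := h2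
  rw [integral_add h5 h6, integral_const_mul] at key
  simp only [Complex.ofReal_zero, Complex.zero_cpow hs0, zero_mul, sub_zero] at key
  rw [mellin, mellin]
  simp only [smul_eq_mul]
  linear_combination key

theorem mellin_iterDeriv (φ : 𝓢(ℝ, ℂ)) {s : ℂ} (hs : 0 < s.re) (N : ℕ) :
    mellin (iterDeriv N φ) (s + N) = (-1) ^ N * (ascPochhammer ℂ N).eval s * mellin φ s := by
  induction N with
  | zero => simp [iterDeriv]
  | succ N ih =>
    have : 0 < (s + N).re := by
      simpa using by positivity
    rw [iterDeriv_succ, Nat.cast_succ, ← add_assoc, mellin_deriv_schwartz _ this, ih,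
      ascPochhammer_succ_eval]
    ring

/-- Fubini and the substitution `u = t x` separate the variables; `Re s > k + 1` gives absolute
convergence in `x`. -/
theorem mellin_integral_dilate (hb : 0 < b) (hc : Continuous C)
    (hC : ∀ x ∈ Ioi b, ‖C x‖ ≤ K * x ^ k) (ψ : 𝓢(ℝ, ℂ)) {s : ℂ} (hs : k + 1 < s.re) :
    mellin (fun t : ℝ => ∫ x in Ioi b, C x * ψ (t * x)) s =
      (∫ x in Ioi b, C x * (x : ℂ) ^ (-s)) * mellin ψ s := by
  have hs0 : 0 < s.re := by
    have : (0 : ℝ) ≤ k := k.cast_nonneg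
    linarith
  let F : ℝ → ℝ → ℂ := fun t x => (t : ℂ) ^ (s - 1) * (C x * ψ (t * x))
  have hin : ∀ x ∈ Ioi b, ∀ t, F t x = C x * ((t : ℂ) ^ (s - 1) • ψ (x * t)) := fun x _ t => by
    simp only [F, smul_eq_mul, mul_comm x t]
    ring
  have hnorm : ∀ x ∈ Ioi b, ∫ t in Ioi 0, ‖F t x‖ =
      ‖C x‖ * x ^ (-s.re) * ∫ u in Ioi 0, u ^ (s.re - 1) * ‖ψ u‖ := fun x hx => by
    have hx0 : 0 < x := hb.trans hx
    have h1 : ∀ t ∈ Ioi (0 : ℝ), ‖F t x‖ =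
        (‖C x‖ * x ^ (1 - s.re)) * ((x * t) ^ (s.re - 1) * ‖ψ (x * t)‖) := fun t ht => by
      have ht0 : (0 : ℝ) < t := ht
      have h2 : x ^ (1 - s.re) * x ^ (s.re - 1) = 1 := by
        rw [← Real.rpow_add hx0]
        simp
      rw [hin x hx t, norm_mul, norm_smul, Complex.norm_cpow_eq_rpow_re_of_pos ht0,
        Real.mul_rpow hx0.le ht0.le, Complex.sub_re, Complex.one_re]
      linear_combination (-‖C x‖ * t ^ (s.re - 1) * ‖ψ (x * t)‖) * h2
    rw [setIntegral_congr_fun measurableSet_Ioi h1, integral_const_mul,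
      integral_comp_mul_left_Ioi (fun u => u ^ (s.re - 1) * ‖ψ u‖) 0 hx0, mul_zero, smul_eq_mul]
    have h3 : x ^ (1 - s.re) * x⁻¹ = x ^ (-s.re) := by
      rw [← Real.rpow_neg_one, ← Real.rpow_add hx0]
      ring_nf
    rw [← h3]
    ring
  have hint : Integrable (Function.uncurry F)
      ((volume.restrict (Ioi 0)).prod (volume.restrict (Ioi b))) := by
    have hmeas : AEStronglyMeasurable (Function.uncurry F)
        ((volume.restrict (Ioi 0)).prod (volume.restrict (Ioi b))) := by
      refine Measurable.aestronglyMeasurable ?_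
      refine Measurable.mul (by fun_prop) (Continuous.measurable ?_)
      exact (hc.comp continuous_snd).mul (ψ.continuous.comp (by fun_prop))
    rw [integrable_prod_iff' hmeas]
    constructor
    · filter_upwards [ae_restrict_mem measurableSet_Ioi] with x hx
      simp only [Function.uncurry, hin x hx]
      exact Integrable.const_mul ((MellinConvergent.comp_mul_left (hb.trans hx)).2
        (mellinConvergent_schwartz ψ hs0)) _
    · have h1 : IntegrableOn (fun x => K * x ^ (k - s.re) *
          ∫ u in Ioi 0, u ^ (s.re - 1) * ‖ψ u‖) (Ioi b) :=
        ((integrableOn_Ioi_rpow_of_lt (by linarith) hb).const_mul K).mul_const _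
      have h2 : IntegrableOn (fun x => ‖C x‖ * x ^ (-s.re) *
          ∫ u in Ioi 0, u ^ (s.re - 1) * ‖ψ u‖) (Ioi b) := by
        refine h1.mono' (Measurable.aestronglyMeasurable ?_) ?_
        · exact (hc.norm.measurable.mul (by fun_prop)).mul_const _
        · filter_upwards [ae_restrict_mem measurableSet_Ioi] with x hx
          have hx0 : 0 < x := hb.trans hx
          have hI : 0 ≤ ∫ u in Ioi 0, u ^ (s.re - 1) * ‖ψ u‖ :=
            setIntegral_nonneg measurableSet_Ioi fun u (hu : 0 < u) => by positivity
          rw [Real.norm_of_nonneg (by positivity), sub_eq_add_neg (k : ℝ), Real.rpow_add hx0,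
            Real.rpow_natCast, ← mul_assoc]
          gcongr
          exact hC x hx
      exact h2.congr_fun (fun x hx => (hnorm x hx).symm) measurableSet_Ioi
  have hswap := integral_integral_swap hint
  have hl : mellin (fun t : ℝ => ∫ x in Ioi b, C x * ψ (t * x)) s =
      ∫ t in Ioi 0, ∫ x in Ioi b, F t x := by
    rw [mellin]
    simp only [smul_eq_mul, F, integral_const_mul]
  rw [hl, hswap, ← integral_mul_const]
  refine setIntegral_congr_fun measurableSet_Ioi fun x hx => ?_
  simp only [hin x hx, integral_const_mul]
  have := mellin_comp_mul_left ψ s (hb.trans hx)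
  rw [mellin] at this
  rw [this, smul_eq_mul, mul_assoc]

end Kernel

/-! ### The two Fourier eigenfunctions and their Mellin transforms -/

section Gaussian

/-- The Gaussian `e ^ (-π x²)`. -/
noncomputable def gaussianFun (x : ℝ) : ℂ := Complex.exp (-Real.pi * x ^ 2)

theorem norm_gaussianFun (x : ℝ) : ‖gaussianFun x‖ = Real.exp (-Real.pi * x ^ 2) := by
  rw [gaussianFun, Complex.norm_exp]
  congr 1
  have : (-(Real.pi : ℂ) * (x : ℂ) ^ 2) = ((-Real.pi * x ^ 2 : ℝ) : ℂ) := by push_cast; ring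
  rw [this, Complex.ofReal_re]

theorem abs_pow_mul_norm_gaussianFun_le (j : ℕ) (x : ℝ) :
    |x| ^ j * ‖gaussianFun x‖ ≤ 1 + j.factorial := by
  rw [norm_gaussianFun, neg_mul, Real.exp_neg, ← div_eq_mul_inv, div_le_iff₀ (Real.exp_pos _)]
  have h1 : |x| ^ j ≤ 1 + (x ^ 2) ^ j := by
    rw [← sq_abs, ← pow_mul, mul_comm 2 j, pow_mul]
    nlinarith [sq_nonneg (|x| ^ j - 1), pow_nonneg (abs_nonneg x) j]
  have h2 : (x ^ 2) ^ j ≤ j.factorial * Real.exp (x ^ 2) := by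
    have := Real.pow_div_factorial_le_exp (x ^ 2) (sq_nonneg x) j
    rwa [div_le_iff₀' (by positivity)] at this
  have h3 : Real.exp (x ^ 2) ≤ Real.exp (Real.pi * x ^ 2) := by
    apply Real.exp_le_exp.2
    nlinarith [Real.pi_gt_three, sq_nonneg x]
  have h4 : 1 ≤ Real.exp (Real.pi * x ^ 2) := Real.one_le_exp (by positivity)
  calc |x| ^ j ≤ 1 + (x ^ 2) ^ j := h1
    _ ≤ 1 + j.factorial * Real.exp (x ^ 2) := by gcongr
    _ ≤ Real.exp (Real.pi * x ^ 2) + j.factorial * Real.exp (Real.pi * x ^ 2) := by gcongr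
    _ = _ := by ring

theorem exists_norm_eval_mul_gaussianFun_le (p : Polynomial ℂ) (k : ℕ) :
    ∃ M : ℝ, ∀ x : ℝ, |x| ^ k * ‖p.eval (x : ℂ) * gaussianFun x‖ ≤ M := by
  induction p using Polynomial.induction_on' with
  | add p q hp hq =>
    obtain ⟨M, hM⟩ := hp
    obtain ⟨M', hM'⟩ := hq
    refine ⟨M + M', fun x => le_trans ?_ (add_le_add (hM x) (hM' x))⟩
    rw [← mul_add, Polynomial.eval_add, add_mul]
    gcongr
    exact norm_add_le _ _
  | monomial n c =>
    refine ⟨‖c‖ * (1 + (k + n).factorial), fun x => ?_⟩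
    rw [Polynomial.eval_monomial, norm_mul, norm_mul, norm_pow, Complex.norm_real, Real.norm_eq_abs]
    calc _ = ‖c‖ * (|x| ^ (k + n) * ‖gaussianFun x‖) := by ring
      _ ≤ _ := by
        gcongr
        exact abs_pow_mul_norm_gaussianFun_le _ x

theorem hasDerivAt_gaussianFun (x : ℝ) :
    HasDerivAt gaussianFun (-(2 * Real.pi * x) * gaussianFun x) x := by
  have h : HasDerivAt (fun z : ℂ => Complex.exp (-Real.pi * z ^ 2))
      (Complex.exp (-Real.pi * (x : ℂ) ^ 2) * (-Real.pi * (2 * x))) x := by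
    simpa using (((hasDerivAt_id (x : ℂ)).pow 2).const_mul (-(Real.pi : ℂ))).cexp
  convert! h.comp_ofReal using 1
  rw [gaussianFun]
  ring

theorem exists_iteratedDeriv_gaussianFun (n : ℕ) :
    ∃ p : Polynomial ℂ, ∀ x : ℝ, iteratedDeriv n gaussianFun x = p.eval (x : ℂ) * gaussianFun x := by
  induction n with
  | zero => exact ⟨1, fun x => by simp⟩
  | succ n ih =>
    obtain ⟨p, hp⟩ := ih
    refine ⟨p.derivative - Polynomial.C (2 * Real.pi : ℂ) * Polynomial.X * p, fun x => ?_⟩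
    rw [iteratedDeriv_succ, funext hp]
    refine (((p.hasDerivAt (x : ℂ)).comp_ofReal).mul (hasDerivAt_gaussianFun x)).deriv.trans ?_
    simp only [Polynomial.eval_sub, Polynomial.eval_mul, Polynomial.eval_C, Polynomial.eval_X]
    ring

/-- The Gaussian `e ^ (-π x²)` as a Schwartz function. -/
noncomputable def gaussian : 𝓢(ℝ, ℂ) where
  toFun := gaussianFun
  smooth' := by
    have : ContDiff ℝ (⊤ : ℕ∞) fun x : ℝ => Complex.exp (-Real.pi * (x : ℂ) ^ 2) :=
      (contDiff_const.mul (Complex.ofRealCLM.contDiff.pow 2)).cexp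
    exact this
  decay' k n := by
    obtain ⟨p, hp⟩ := exists_iteratedDeriv_gaussianFun n
    obtain ⟨M, hM⟩ := exists_norm_eval_mul_gaussianFun_le p k
    refine ⟨M, fun x => ?_⟩
    rw [norm_iteratedFDeriv_eq_norm_iteratedDeriv, hp, Real.norm_eq_abs]
    exact hM x

theorem gaussian_apply (x : ℝ) : gaussian x = Complex.exp (-Real.pi * x ^ 2) := rfl

/-- The odd function `x e ^ (-π x²)` as a Schwartz function. -/
noncomputable def oddGaussian : 𝓢(ℝ, ℂ) := (-(2 * Real.pi : ℂ)⁻¹) • derivCLM ℂ ℂ gaussian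

theorem oddGaussian_apply (x : ℝ) : oddGaussian x = x * gaussian x := by
  have h : deriv gaussian x = -(2 * Real.pi * x) * gaussian x := (hasDerivAt_gaussianFun x).deriv
  have hpi : (Real.pi : ℂ) ≠ 0 := by simp [Real.pi_ne_zero]
  rw [oddGaussian, smul_apply, derivCLM_apply, h, smul_eq_mul]
  field_simp

theorem reflect_gaussian : reflect gaussian = (1 : ℂ) • gaussian := by
  ext x
  simp [reflect_apply, gaussian_apply]

theorem reflect_oddGaussian : reflect oddGaussian = (-1 : ℂ) • oddGaussian := by
  ext x
  simp [reflect_apply, oddGaussian_apply, gaussian_apply]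

theorem fourier_gaussian : 𝓕 gaussian = (1 : ℂ) • gaussian := by
  ext x
  have h := congrFun (fourier_gaussian_pi (b := 1) (by simp)) x
  have h1 : (gaussian : ℝ → ℂ) = fun x : ℝ => Complex.exp (-Real.pi * 1 * (x : ℂ) ^ 2) := by
    ext x
    rw [gaussian_apply, mul_one]
  rw [fourier_coe, one_smul, h1, h]
  simp

/-- `oddGaussian` is a multiple of the derivative of `gaussian`, and `𝓕` turns that derivative into
multiplication by `2πix`. The eigenvalue is the `-i` of the odd functional equation. -/
theorem fourier_oddGaussian : 𝓕 oddGaussian = (-Complex.I) • oddGaussian := by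
  have hd : 𝓕 (derivCLM ℂ ℂ gaussian) = (2 * Real.pi : ℂ) • Complex.I • oddGaussian := by
    ext x
    have h := congrFun (Real.fourier_deriv gaussian.integrable gaussian.differentiable
      (derivCLM ℂ ℂ gaussian).integrable) x
    rw [fourier_coe]
    refine h.trans ?_
    rw [← fourier_coe, fourier_gaussian, one_smul]
    simp only [smul_apply, oddGaussian_apply, smul_eq_mul]
    ring
  have hpi : (Real.pi : ℂ) ≠ 0 := by simp [Real.pi_ne_zero]
  conv_lhs => rw [oddGaussian]
  rw [FourierTransform.fourier_smul, hd, smul_smul, smul_smul]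
  congr 1
  field_simp

theorem fourier_dilate {t : ℝ} (ht : 0 < t) (φ : 𝓢(ℝ, ℂ)) :
    𝓕 (dilate t φ) = (t : ℂ)⁻¹ • dilate t⁻¹ (𝓕 φ) := by
  ext y
  rw [smul_apply, dilate_apply (inv_ne_zero ht.ne'), fourier_coe, fourier_coe, Real.fourier_real_eq,
    Real.fourier_real_eq]
  have h := Measure.integral_comp_mul_left
    (fun v : ℝ => 𝐞 (-(v * (t⁻¹ * y))) • φ v) t
  rw [abs_of_pos (inv_pos.2 ht)] at h
  have h2 : ((t : ℂ)⁻¹) = ((t⁻¹ : ℝ) : ℂ) := by simp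
  rw [h2, Complex.coe_smul, ← h]
  refine integral_congr_ae (ae_of_all _ fun v => ?_)
  simp only
  rw [dilate_apply ht.ne']
  congr 3
  field_simp

theorem mellin_gaussian {s : ℂ} (hs : 0 < s.re) : mellin gaussian s = Complex.Gammaℝ s / 2 := by
  have h1 : mellin (fun t : ℝ => Complex.exp (-(Real.pi * t : ℝ))) (s / 2) =
      (1 / (Real.pi : ℂ)) ^ (s / 2) * Complex.Gamma (s / 2) := by
    have := Complex.integral_cpow_mul_exp_neg_mul_Ioi (a := s / 2) (r := Real.pi)
      (by simpa using hs) Real.pi_pos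
    simpa [mellin] using this
  have h2 := mellin_comp_rpow (fun t : ℝ => Complex.exp (-(Real.pi * t : ℝ))) s 2
  have h3 : (fun t : ℝ => Complex.exp (-(Real.pi * t ^ (2 : ℝ) : ℝ))) = gaussian := by
    ext t
    rw [gaussian_apply, Real.rpow_two]
    push_cast
    ring_nf
  rw [h3, Complex.ofReal_ofNat, h1] at h2
  rw [h2, Complex.Gammaℝ_def, one_div, Complex.inv_cpow, neg_div, Complex.cpow_neg]
  · simp
    ring
  · rw [Complex.arg_ofReal_of_nonneg Real.pi_pos.le]
    exact Real.pi_ne_zero.symm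

theorem mellin_oddGaussian {s : ℂ} (hs : 0 < s.re) :
    mellin oddGaussian s = Complex.Gammaℝ (s + 1) / 2 := by
  rw [← mellin_gaussian (by simpa using by linarith), ← mellin_cpow_smul]
  congr 1
  ext t
  rw [oddGaussian_apply, Complex.cpow_one, smul_eq_mul]

end Gaussian

/-! ### Fourier symmetry of the theta function -/

section FourierPlus

theorem fourierInv_eq_reflect_fourier (ψ : 𝓢(ℝ, ℂ)) : 𝓕⁻ ψ = reflect (𝓕 ψ) := by
  ext x
  rw [fourierInv_apply_eq]
  rfl

theorem fourier_reflect (ψ : 𝓢(ℝ, ℂ)) : 𝓕 (reflect ψ) = 𝓕⁻ ψ := by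
  ext x
  rw [fourier_coe, fourierInv_coe, Real.fourierInv_eq_fourier_comp_neg]
  rfl

theorem fourierInv_reflect (ψ : 𝓢(ℝ, ℂ)) : 𝓕⁻ (reflect ψ) = reflect (𝓕⁻ ψ) := by
  rw [fourierInv_eq_reflect_fourier, fourier_reflect]

theorem fourierInv_fourierInv (ψ : 𝓢(ℝ, ℂ)) : 𝓕⁻ (𝓕⁻ ψ) = reflect ψ := by
  rw [fourierInv_eq_reflect_fourier ψ, fourierInv_reflect, FourierTransform.fourierInv_fourier_eq]

variable {D : 𝓢'(ℝ, ℂ)} {η : ℂ}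

theorem fourierPlus_reflect (hpar : ∀ ψ, D (reflect ψ) = η * D ψ) (ψ : 𝓢(ℝ, ℂ)) :
    fourierPlus D (reflect ψ) = η * fourierPlus D ψ := by
  rw [fourierPlus_apply, fourierPlus_apply, fourierInv_reflect, hpar]

/-- Applying `fourierPlus` twice reflects, hence gives back `η • D`. -/
theorem PropertyS.fourierPlus (hD : PropertyS D) (hpar : ∀ ψ, D (reflect ψ) = η * D ψ) :
    PropertyS (fourierPlus D) := by
  obtain ⟨a, ha, h1, h2⟩ := hD
  refine ⟨a, ha, h2, fun ψ hψ => ?_⟩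
  rw [fourierPlus_apply, fourierPlus_apply, fourierInv_fourierInv, hpar, h1 ψ hψ, mul_zero]

/-- Inserting `𝓕⁻ (𝓕 ·)` moves `D` to `fourierPlus D`, and `𝓕` inverts the dilation. -/
theorem theta_one_div {φ : 𝓢(ℝ, ℂ)} {c : ℂ} (hφ : 𝓕 φ = c • φ) {t : ℝ} (ht : 0 < t) :
    theta D φ (1 / t) = (c * t) • theta (fourierPlus D) φ t := by
  have h : D (dilate (1 / t) φ) = fourierPlus D (𝓕 (dilate (1 / t) φ)) := by
    rw [fourierPlus_apply, FourierTransform.fourierInv_fourier_eq]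
  rw [theta, theta, h, fourier_dilate (by positivity), hφ, one_div, inv_inv]
  have h2 : dilate t (c • φ) = c • dilate t φ := by
    ext x
    simp [dilate_apply ht.ne']
  rw [h2, map_smul, map_smul, smul_smul]
  congr 1
  push_cast
  rw [inv_inv, mul_comm]

end FourierPlus

/-! ### Entire Mellin transform of theta and its quotient by the Gamma factor -/

section Theta

variable {D : 𝓢'(ℝ, ℂ)} {η c : ℂ} {φ : 𝓢(ℝ, ℂ)}

theorem continuousOn_theta {a : ℝ} (ha : 0 < a)
    (hD : Distribution.IsVanishingOn D (Ioo (-a) a)) (hη : η * η = 1)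
    (hpar : ∀ ψ, D (reflect ψ) = η * D ψ) (hφ : reflect φ = η • φ) :
    ContinuousOn (theta D φ) (Ioi 0) := by
  obtain ⟨b, hb, N, C, hC⟩ := exists_isPrimitive ha hD
  obtain ⟨K, k, hK, hle⟩ := hC.exists_norm_le_mul_pow hb
  have h : ContinuousOn (fun t : ℝ => (t : ℂ) ^ N •
      ((2 * (-1) ^ N : ℂ) • ∫ x in Ioi b, C x * iterDeriv N φ (t * x))) (Ioi 0) :=
    ContinuousOn.smul (f := fun t : ℝ => (t : ℂ) ^ N) (by fun_prop)
      ((continuousOn_integral_dilate hb hK hC.continuous hle _).const_smul (2 * (-1) ^ N : ℂ))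
  refine h.congr fun t ht => ?_
  rw [theta_eq_integral ha hb hD hη hpar hC hφ ht, Complex.cpow_natCast]

theorem isBigO_theta {a : ℝ} (ha : 0 < a)
    (hD : Distribution.IsVanishingOn D (Ioo (-a) a)) (hη : η * η = 1)
    (hpar : ∀ ψ, D (reflect ψ) = η * D ψ) (hφ : reflect φ = η • φ) (r : ℝ) :
    theta D φ =O[atTop] fun t : ℝ => t ^ r := by
  obtain ⟨b, hb, N, C, hC⟩ := exists_isPrimitive ha hD
  obtain ⟨K, k, hK, hle⟩ := hC.exists_norm_le_mul_pow hb
  -- This much decay of the integral beats the prefactor `t ^ N` and leaves at most `t ^ r`.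
  obtain ⟨j, hj⟩ := exists_nat_ge (N - r)
  obtain ⟨M, hM⟩ := exists_norm_integral_dilate_le hb hK hle (iterDeriv N φ) j
  have hM0 : 0 ≤ M := by simpa using (norm_nonneg _).trans (hM 1 one_pos)
  refine Asymptotics.IsBigO.of_bound (2 * M) ?_
  filter_upwards [eventually_ge_atTop 1] with t ht
  have ht0 : 0 < t := one_pos.trans_le ht
  rw [theta_eq_integral ha hb hD hη hpar hC hφ ht0, Complex.cpow_natCast, norm_smul, norm_smul,
    norm_mul, norm_pow, norm_pow, norm_neg, norm_one, one_pow, Complex.norm_real,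
    Real.norm_of_nonneg ht0.le, Complex.norm_ofNat, mul_one, Real.norm_of_nonneg (by positivity)]
  have h1 : t ^ N * (t ^ (k + (j + 2)))⁻¹ ≤ t ^ r := by
    rw [← Real.rpow_natCast, ← Real.rpow_natCast t (k + (j + 2)), ← Real.rpow_neg ht0.le,
      ← Real.rpow_add ht0]
    apply Real.rpow_le_rpow_of_exponent_le ht
    push_cast
    have : (0 : ℝ) ≤ k := k.cast_nonneg
    linarith
  calc _ ≤ t ^ N * (2 * (M * (t ^ (k + (j + 2)))⁻¹)) := by
        gcongr
        exact hM t ht0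
    _ = 2 * M * (t ^ N * (t ^ (k + (j + 2)))⁻¹) := by ring
    _ ≤ _ := by gcongr

/-- The Mellin transform of `theta D φ` is entire and satisfies a functional equation. -/
theorem differentiable_mellin_theta (hD : PropertyS D) (hη : η * η = 1)
    (hpar : ∀ ψ, D (reflect ψ) = η * D ψ) (hφ : reflect φ = η • φ) (hc : c ≠ 0)
    (hF : 𝓕 φ = c • φ) :
    Differentiable ℂ (mellin (theta D φ)) ∧
      ∀ s, mellin (theta D φ) s = c * mellin (theta (fourierPlus D) φ) (1 - s) := by
  obtain ⟨a, ha, h1, h2⟩ := hD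
  let P : WeakFEPair ℂ :=
    { f := theta D φ
      g := theta (fourierPlus D) φ
      k := 1
      ε := c
      f₀ := 0
      g₀ := 0
      hf_int := (continuousOn_theta ha h1 hη hpar hφ).locallyIntegrableOn measurableSet_Ioi
      hg_int := (continuousOn_theta ha h2 hη (fourierPlus_reflect hpar) hφ).locallyIntegrableOn
        measurableSet_Ioi
      hk := one_pos
      hε := hc
      h_feq := fun t ht => by
        rw [Real.rpow_one]
        exact theta_one_div hF ht
      hf_top := fun r => by simpa using isBigO_theta ha h1 hη hpar hφ r
      hg_top := fun r => by simpa using isBigO_theta ha h2 hη (fourierPlus_reflect hpar) hφ r }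
  -- Zero constant terms at infinity mean that the Mellin transform has no poles.
  have hP : IsStrongFEPair P := ⟨rfl, rfl⟩
  have e1 : mellin (theta D φ) = P.Λ := funext fun s => (hP.hasMellin s).2
  have e2 : mellin (theta (fourierPlus D) φ) = P.symm.Λ :=
    funext fun s => (hP.symm.hasMellin s).2
  refine ⟨e1 ▸ hP.differentiable_Λ, fun s => ?_⟩
  have h3 := P.functional_equation (1 - s)
  have h4 : ((P.k : ℝ) : ℂ) - (1 - s) = s := by
    change ((1 : ℝ) : ℂ) - (1 - s) = s
    push_cast
    ring
  rw [h4] at h3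
  rw [e1, e2]
  exact h3

/-- The factor `2` comes from parity; the sign `(-1) ^ N` of the primitive cancels that of
`mellin_iterDeriv`. -/
theorem exists_mellin_theta_eq {a b : ℝ} (ha : 0 < a) (hb : 0 < b)
    (hD : Distribution.IsVanishingOn D (Ioo (-a) a)) (hη : η * η = 1)
    (hpar : ∀ ψ, D (reflect ψ) = η * D ψ) (hφ : reflect φ = η • φ)
    {N : ℕ} {C : ℝ → ℂ} (hC : IsPrimitive D b N C) :
    ∃ σ : ℝ, 0 ≤ σ ∧ ∀ s : ℂ, σ < s.re → mellin (theta D φ) s = 2 * mellin φ s *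
      ((ascPochhammer ℂ N).eval s * ∫ x in Ioi (0 : ℝ), C x * (x : ℂ) ^ (-(s + N))) := by
  obtain ⟨K, k, hK, hle⟩ := hC.exists_norm_le_mul_pow hb
  refine ⟨k + 1, by positivity, fun s hs => ?_⟩
  have hs0 : 0 < s.re := lt_of_le_of_lt (by positivity) hs
  have h1 : mellin (theta D φ) s = mellin (fun t : ℝ => (t : ℂ) ^ (N : ℂ) •
      ((2 * (-1) ^ N : ℂ) • ∫ x in Ioi b, C x * iterDeriv N φ (t * x))) s :=
    setIntegral_congr_fun measurableSet_Ioi fun t ht => by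
      simp only
      rw [theta_eq_integral ha hb hD hη hpar hC hφ ht]
  have h2 : ∫ x in Ioi (0 : ℝ), C x * (x : ℂ) ^ (-(s + N)) =
      ∫ x in Ioi b, C x * (x : ℂ) ^ (-(s + N)) := by
    refine setIntegral_eq_of_subset_of_forall_sdiff_eq_zero measurableSet_Ioi
      (Ioi_subset_Ioi hb.le) fun x hx => ?_
    rw [hC.eq_zero x (not_lt.1 hx.2), zero_mul]
  rw [h1, mellin_cpow_smul, mellin_const_smul, mellin_integral_dilate hb hC.continuous hle
    (iterDeriv N φ) (by simpa using by linarith [(N.cast_nonneg : (0 : ℝ) ≤ N)]),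
    mellin_iterDeriv φ hs0, h2, smul_eq_mul]
  have h3 : ((-1 : ℂ) ^ N) * (-1) ^ N = 1 := by
    rw [← mul_pow]
    simp
  linear_combination (2 * (∫ x in Ioi b, C x * (x : ℂ) ^ (-(s + N))) *
    ((ascPochhammer ℂ N).eval s * mellin φ s)) * h3

theorem halfPlane_bot : halfPlane ⊥ = univ :=
  eq_univ_of_forall fun _ => EReal.bot_lt_coe _

theorem rightMellin_eq (hD : PropertyS D) (hη : η * η = 1)
    (hpar : ∀ ψ, D (reflect ψ) = η * D ψ) (hφ : reflect φ = η • φ) (hc : c ≠ 0)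
    (hF : 𝓕 φ = c • φ) {G : ℂ → ℂ} (hG : ∀ s : ℂ, 0 < s.re → mellin φ s = G s / 2)
    (hG0 : ∀ s : ℂ, 0 < s.re → G s ≠ 0) (hGd : Differentiable ℂ fun s => (G s)⁻¹) :
    mellinAbscissa D = ⊥ ∧ IsMellinOn D ⊥ (rightMellin D) ∧ Differentiable ℂ (rightMellin D) ∧
      ∀ s, rightMellin D s = mellin (theta D φ) s * (G s)⁻¹ := by
  have hE := (differentiable_mellin_theta hD hη hpar hφ hc hF).1
  obtain ⟨a, ha, hDa, -⟩ := hD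
  -- All primitives are covered, because the function chosen by `Classical.epsilon` comes with an
  -- unknown one. Agreement far to the right then identifies it by the identity theorem.
  have hlarge : ∀ (b : ℝ), 0 < b → ∀ (N : ℕ) (C : ℝ → ℂ), IsPrimitive D b N C →
      ∃ σ : ℝ, ∀ s : ℂ, σ < s.re → mellin (theta D φ) s * (G s)⁻¹ =
        (ascPochhammer ℂ N).eval s * ∫ x in Ioi (0 : ℝ), C x * (x : ℂ) ^ (-(s + N)) := by
    intro b hb N C hC
    obtain ⟨σ, hσ, h⟩ := exists_mellin_theta_eq ha hb hDa hη hpar hφ hC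
    refine ⟨σ, fun s hs => ?_⟩
    have hs0 : 0 < s.re := hσ.trans_lt hs
    rw [h s hs, hG s hs0]
    have := hG0 s hs0
    field_simp
  have hEd : Differentiable ℂ fun s => mellin (theta D φ) s * (G s)⁻¹ := hE.mul hGd
  have hex : IsMellinOn D ⊥ fun s => mellin (theta D φ) s * (G s)⁻¹ := by
    obtain ⟨b, hb, N, C, hC⟩ := exists_isPrimitive ha hDa
    exact ⟨hEd.differentiableOn, b, hb, N, C, hC, hlarge b hb N C hC⟩
  have habs : mellinAbscissa D = ⊥ := le_antisymm (sInf_le ⟨_, hex⟩) bot_le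
  have hR : IsMellinOn D ⊥ (rightMellin D) := by
    rw [rightMellin, habs]
    exact Classical.epsilon_spec ⟨_, hex⟩
  have hRd : Differentiable ℂ (rightMellin D) := by
    rw [← differentiableOn_univ, ← halfPlane_bot]
    exact hR.1
  refine ⟨habs, hR, hRd, ?_⟩
  obtain ⟨-, b, hb, N, C, hC, σ₀, h0⟩ := hR
  obtain ⟨σ, h⟩ := hlarge b hb N C hC
  have hev : rightMellin D =ᶠ[𝓝 ((max σ₀ σ + 1 : ℝ) : ℂ)]
      fun s => mellin (theta D φ) s * (G s)⁻¹ := by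
    have ho : IsOpen {s : ℂ | max σ₀ σ < s.re} := isOpen_lt continuous_const Complex.continuous_re
    filter_upwards [ho.mem_nhds (lt_add_one (max σ₀ σ))] with s hs
    rw [h0 s ((le_max_left _ _).trans_lt hs), h s ((le_max_right _ _).trans_lt hs)]
  exact congrFun (AnalyticOnNhd.eq_of_eventuallyEq (fun z _ => hRd.analyticAt z)
    (fun z _ => hEd.analyticAt z) hev)

end Theta

/-! ### Even and odd cases -/

section Cases

variable {D : 𝓢'(ℝ, ℂ)}

theorem IsEven.reflect_eq (h : IsEven D) (ψ : 𝓢(ℝ, ℂ)) : D (reflect ψ) = 1 * D ψ := by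
  rw [h ψ, one_mul]

theorem IsOdd.reflect_eq (h : IsOdd D) (ψ : 𝓢(ℝ, ℂ)) : D (reflect ψ) = -1 * D ψ := by
  rw [h ψ, neg_one_mul]

theorem IsEven.rightMellin_eq (h : IsEven D) (hD : PropertyS D) :
    mellinAbscissa D = ⊥ ∧ IsMellinOn D ⊥ (rightMellin D) ∧ Differentiable ℂ (rightMellin D) ∧
      ∀ s, rightMellin D s = mellin (theta D gaussian) s * (Complex.Gammaℝ s)⁻¹ :=
  CoPoisson.rightMellin_eq hD (one_mul 1) h.reflect_eq reflect_gaussian one_ne_zero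
    fourier_gaussian (fun _ => mellin_gaussian) (fun _ => Complex.Gammaℝ_ne_zero_of_re_pos)
    Complex.differentiable_Gammaℝ_inv

theorem IsOdd.rightMellin_eq (h : IsOdd D) (hD : PropertyS D) :
    mellinAbscissa D = ⊥ ∧ IsMellinOn D ⊥ (rightMellin D) ∧ Differentiable ℂ (rightMellin D) ∧
      ∀ s, rightMellin D s = mellin (theta D oddGaussian) s * (Complex.Gammaℝ (s + 1))⁻¹ :=
  CoPoisson.rightMellin_eq (G := fun s => Complex.Gammaℝ (s + 1)) hD (by norm_num) h.reflect_eq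
    reflect_oddGaussian (neg_ne_zero.2 Complex.I_ne_zero) fourier_oddGaussian
    (fun _ => mellin_oddGaussian)
    (fun s hs => Complex.Gammaℝ_ne_zero_of_re_pos (by simpa using by linarith))
    (Complex.differentiable_Gammaℝ_inv.comp (differentiable_id.add_const 1))

end Cases

end CoPoisson

open CoPoisson
theorem mainTheorem8 (D : 𝓢'(ℝ, ℂ)) (hD : PropertyS D) :
    -- the Mellin transform exists and is entire
    (IsEven D ∨ IsOdd D →
      mellinAbscissa D = ⊥ ∧ IsMellinOn D ⊥ (rightMellin D) ∧
        Differentiable ℂ (rightMellin D)) ∧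
    -- trivial zeros and functional equation, even case
    (IsEven D →
      (∀ n : ℕ, rightMellin D (-(2 * n)) = 0) ∧
      ∀ s : ℂ, (∀ n : ℕ, s ≠ -(2 * n)) → (∀ n : ℕ, s ≠ 1 + 2 * n) →
        (Real.pi : ℂ) ^ (-s / 2) * Complex.Gamma (s / 2) * rightMellin D s =
          (Real.pi : ℂ) ^ (-(1 - s) / 2) * Complex.Gamma ((1 - s) / 2) *
            rightMellin (fourierPlus D) (1 - s)) ∧
    -- trivial zeros and functional equation, odd case
    (IsOdd D →
      (∀ n : ℕ, rightMellin D (-(1 + 2 * n)) = 0) ∧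
      ∀ s : ℂ, (∀ n : ℕ, s ≠ -(1 + 2 * n)) → (∀ n : ℕ, s ≠ 2 + 2 * n) →
        (Real.pi : ℂ) ^ (-(1 + s) / 2) * Complex.Gamma ((1 + s) / 2) * rightMellin D s =
          -Complex.I * (Real.pi : ℂ) ^ (-(2 - s) / 2) * Complex.Gamma ((2 - s) / 2) *
            rightMellin (fourierPlus D) (1 - s)) := by
  refine ⟨?_, fun h => ?_, fun h => ?_⟩
  · rintro (h | h)
    · exact ⟨(h.rightMellin_eq hD).1, (h.rightMellin_eq hD).2.1, (h.rightMellin_eq hD).2.2.1⟩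
    · exact ⟨(h.rightMellin_eq hD).1, (h.rightMellin_eq hD).2.1, (h.rightMellin_eq hD).2.2.1⟩
  · obtain ⟨-, -, -, hM⟩ := h.rightMellin_eq hD
    have h' : IsEven (fourierPlus D) := fun ψ =>
      (fourierPlus_reflect h.reflect_eq ψ).trans (one_mul _)
    obtain ⟨-, -, -, hM'⟩ := h'.rightMellin_eq (hD.fourierPlus h.reflect_eq)
    refine ⟨fun n => ?_, fun s hs hs' => ?_⟩
    -- `Gammaℝ` takes the value `0` at its poles, so its inverse there is `0`, the true value of the
    -- entire function `1 / Gammaℝ`.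
    · rw [hM, Complex.Gammaℝ_eq_zero_iff.2 ⟨n, rfl⟩, inv_zero, mul_zero]
    · have g1 : Complex.Gammaℝ s ≠ 0 := fun h0 => by
        obtain ⟨n, hn⟩ := Complex.Gammaℝ_eq_zero_iff.1 h0
        exact hs n hn
      have g2 : Complex.Gammaℝ (1 - s) ≠ 0 := fun h0 => by
        obtain ⟨n, hn⟩ := Complex.Gammaℝ_eq_zero_iff.1 h0
        exact hs' n (by linear_combination -hn)
      have hfe := (differentiable_mellin_theta hD (one_mul 1) h.reflect_eq reflect_gaussian
        one_ne_zero fourier_gaussian).2 s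
      rw [← Complex.Gammaℝ_def, ← Complex.Gammaℝ_def, hM, hM', hfe]
      field_simp
  · obtain ⟨-, -, -, hM⟩ := h.rightMellin_eq hD
    have h' : IsOdd (fourierPlus D) := fun ψ =>
      (fourierPlus_reflect h.reflect_eq ψ).trans (neg_one_mul _)
    obtain ⟨-, -, -, hM'⟩ := h'.rightMellin_eq (hD.fourierPlus h.reflect_eq)
    refine ⟨fun n => ?_, fun s hs hs' => ?_⟩
    · rw [hM, Complex.Gammaℝ_eq_zero_iff.2 ⟨n, by ring⟩, inv_zero, mul_zero]
    · have g1 : Complex.Gammaℝ (1 + s) ≠ 0 := fun h0 => by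
        obtain ⟨n, hn⟩ := Complex.Gammaℝ_eq_zero_iff.1 h0
        exact hs n (by linear_combination hn)
      have g2 : Complex.Gammaℝ (2 - s) ≠ 0 := fun h0 => by
        obtain ⟨n, hn⟩ := Complex.Gammaℝ_eq_zero_iff.1 h0
        exact hs' n (by linear_combination -hn)
      have hfe := (differentiable_mellin_theta hD (by norm_num) h.reflect_eq reflect_oddGaussian
        (neg_ne_zero.2 Complex.I_ne_zero) fourier_oddGaussian).2 s
      rw [mul_assoc (-Complex.I), ← Complex.Gammaℝ_def, ← Complex.Gammaℝ_def, hM, hM', hfe,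
        add_comm s 1, show 1 - s + 1 = 2 - s by ring]
      field_simp
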